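/- **Conventions.** All systems are finite-dimensional. A state is a positive semidefinite matrix of trace one. A channel $A\to B$ is a completely positive trace-preserving linear map. Logarithms are natural, exponents take values in $[-\infty,+\infty]$, and $-\ln 0=+\infty$. For a state $\rho$, a positive semidefinite $\sigma$ and $\alpha\in(0,1)$ put $\sigma_\varepsilon=\sigma+\varepsilon I$ and $$\widehat D_\alpha(\rho\Vert\sigma)=\frac1{\alpha-1}\ln\lim_{\varepsilon\to0^+}\operatorname{Tr}\bigl[\sigma_\varepsilon(\sigma_\varepsilon^{-1/2}\rho\,\sigma_\varepsilon^{-1/2})^\alpha\bigr].$$ For channels $\mathcal N,\mathcal M$ from $A$ to $B$ let $$\widehat D_\alpha(\mathcal N\Vert\mathcal M)=\sup_{\rho_{RA}}\widehat D_\alpha\bigl((\mathrm{id}_R\otimes\mathcal N)(\rho_{RA})\Vert(\mathrm{id}_R\otimes\mathcal M)(\rho_{RA})\bigr),$$ where the supremum is over all reference systems $R$ and all states $\rho_{RA}$. The geometric Chernoff information is $\widehat C(\mathcal N\Vert\mathcal M)=\sup_{\alpha\in(0,1)}(1-\alpha)\widehat D_\alpha(\mathcal N\Vert\mathcal M)$.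 **Protocols.** A strategy $\mathcal S^{(n)}$ with $n\ge1$ calls consists of a state $\rho_{R_1A_1}$ and channels $\mathcal S^i_{R_iB_i\to R_{i+1}A_{i+1}}$, $1\le i\le n-1$, with reference systems $R_i$ of arbitrary dimension. Used with the unknown channel $\mathcal K\in\{\mathcal N,\mathcal M\}$ it produces the state $$\omega^{\mathcal K}=(\mathcal K\circ\mathcal S^{n-1}\circ\cdots\circ\mathcal S^1\circ\mathcal K)(\rho_{R_1A_1})\quad\text{of } R_nB_n.$$ An $(n,m)$ protocol for sequential channel discrimination with repetition is such a strategy together with an operator $0\le\Lambda\le I$ on $(R_nB_n)^{m}$. Its error probabilities are $$\alpha_{n,m}=\operatorname{Tr}[(I-\Lambda)(\omega^{\mathcal N})^{\otimes m}],\qquad \beta_{n,m}=\operatorname{Tr}[\Lambda(\omega^{\mathcal M})^{\otimes m}].$$ For $p\in(0,1)$ and $r>0$, with $\inf$ and $\sup$ over all $(n,m)$ protocols, set $$\xi_{n,m}(p)=-\frac1{nm}\ln\inf\bigl\{p\,\alpha_{n,m}+(1-p)\beta_{n,m}\bigr\},\qquad B_{n,m}(r)=\sup\Bigl\{-\frac1{nm}\ln\alpha_{n,m}\;:\;-\frac1{nm}\ln\beta_{n,m}\ge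 r\Bigr\}.$$ **Proposition.** Let $\mathcal N,\mathcal M$ be quantum channels from $A$ to $B$. 1. For every $p\in(0,1)$, $\displaystyle\limsup_{n\to\infty}\limsup_{m\to\infty}\xi_{n,m}(p)\le\widehat C(\mathcal N\Vert\mathcal M).$ 2. For every $r>0$ with $r\neq\inf_{\alpha\in(0,1)}\widehat D_\alpha(\mathcal N\Vert\mathcal M)$, $$\limsup_{n\to\infty}\limsup_{m\to\infty}B_{n,m}(r)\le\sup_{\alpha\in(0,1)}\frac{\alpha-1}{\alpha}\bigl(r-\widehat D_\alpha(\mathcal N\Vert\mathcal M)\bigr).$$ -/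

import Mathlib

open Filter Topology
open scoped ENNReal ComplexOrder

noncomputable section

namespace ChannelDiscrimination

universe u v

/-! ### States, channels, tests -/

/-- A quantum state on the finite-dimensional system `ℂ^ι`: a density matrix. -/
structure QState (ι : Type u) [Fintype ι] where
  mat : Matrix ι ι ℂ
  posSemidef : mat.PosSemidef
  trace_eq_one : mat.trace = 1

/-- The map `id_R ⊗ Φ`, acting blockwise on matrices over `R × A`. -/
def ampliate {R A B : Type*} (Φ : Matrix A A ℂ →ₗ[ℂ] Matrix B B ℂ)
    (X : Matrix (R × A) (R × A) ℂ) : Matrix (R × B) (R × B) ℂ :=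
  Matrix.of fun p q => Φ (Matrix.of fun x y => X (p.1, x) (q.1, y)) p.2 q.2

/-- A quantum channel: a completely positive trace-preserving linear map. -/
structure QChannel (A : Type u) (B : Type v) [Fintype A] [Fintype B] where
  toLin : Matrix A A ℂ →ₗ[ℂ] Matrix B B ℂ
  completelyPositive : ∀ (k : ℕ) (X : Matrix (Fin k × A) (Fin k × A) ℂ),
    X.PosSemidef → (ampliate toLin X).PosSemidef
  tracePreserving : ∀ X : Matrix A A ℂ, (toLin X).trace = X.trace

/-- A two-outcome measurement `{Λ, 1 - Λ}`. -/
structure QTest (ι : Type u) [Fintype ι] [DecidableEq ι] where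
  op : Matrix ι ι ℂ
  posSemidef : op.PosSemidef
  compl_posSemidef : (1 - op).PosSemidef

/-- The `m`-fold tensor power `X ⊗ ⋯ ⊗ X`, as a matrix over `ι^m`. -/
def tensorPow {ι : Type*} (m : ℕ) (X : Matrix ι ι ℂ) : Matrix (Fin m → ι) (Fin m → ι) ℂ :=
  Matrix.of fun f g => ∏ i, X (f i) (g i)

/-! ### Geometric Rényi relative entropy -/

section Geometric

variable {ι : Type*} [Fintype ι] [DecidableEq ι]

/-- Real power `X ^ s` of a Hermitian matrix, by functional calculus. -/
def matPow (X : Matrix ι ι ℂ) (s : ℝ) : Matrix ι ι ℂ :=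
  cfc (fun x : ℝ => x ^ s) X

/-- `Tr[σ_ε (σ_ε^{-1/2} ρ σ_ε^{-1/2})^α]` with `σ_ε = σ + ε 1`. -/
def geomQuasiReg (α : ℝ) (ρ σ : Matrix ι ι ℂ) (ε : ℝ) : ℝ :=
  let σε := σ + (ε : ℂ) • (1 : Matrix ι ι ℂ)
  (Matrix.trace (σε * matPow (matPow σε (-1 / 2) * ρ * matPow σε (-1 / 2)) α)).re

/-- The geometric Rényi relative quasi-entropy: the limit of `geomQuasiReg` as `ε → 0⁺`. For
positive semidefinite `ρ`, `σ` this limit exists in `[0, ∞]`, and the `limsup` is then its value. -/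
def geomQuasi (α : ℝ) (ρ σ : Matrix ι ι ℂ) : ℝ≥0∞ :=
  limsup (fun ε : ℝ => ENNReal.ofReal (geomQuasiReg α ρ σ ε)) (𝓝[>] 0)

/-- The geometric Rényi relative entropy `(α - 1)⁻¹ ln Q̂_α(ρ‖σ)`, with `ln 0 = -∞`. -/
def geomRenyi (α : ℝ) (ρ σ : Matrix ι ι ℂ) : EReal :=
  ((1 / (α - 1) : ℝ) : EReal) * ENNReal.log (geomQuasi α ρ σ)

end Geometric

section Channels

variable {A : Type u} {B : Type v} [Fintype A] [Fintype B] [DecidableEq B]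

/-- The geometric Rényi relative entropy of channels: supremum over all finite-dimensional
reference systems `R` and all states of `RA`. -/
def geomRenyiChannel (α : ℝ) (N M : QChannel A B) : EReal :=
  ⨆ (k : ℕ) (ρ : QState (Fin k × A)),
    geomRenyi α (ampliate N.toLin ρ.mat) (ampliate M.toLin ρ.mat)

/-- The geometric Chernoff information of channels. -/
def geomChernoff (N M : QChannel A B) : EReal :=
  ⨆ α ∈ Set.Ioo (0 : ℝ) 1, ((1 - α : ℝ) : EReal) * geomRenyiChannel α N M

end Channels

/-! ### Sequential discrimination with repetition -/

/-- An adaptive strategy `𝒮^(n)` making `n ≥ 1` calls to a channel from `A` to `B`, whose last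
reference system is `ℂ^k`. `SeqStrategy A B n k` consists of an initial state of `R₁A₁` and
interleaved channels `R_i B_i → R_{i+1} A_{i+1}` for `1 ≤ i < n`; the dimensions of the reference
systems are arbitrary. -/
inductive SeqStrategy (A : Type u) (B : Type v) [Fintype A] [Fintype B] :
    ℕ → ℕ → Type (max u v)
  | start {k : ℕ} (ρ : QState (Fin k × A)) : SeqStrategy A B 1 k
  | step {n k k' : ℕ} (S : SeqStrategy A B n k) (T : QChannel (Fin k × B) (Fin k' × A)) :
      SeqStrategy A B (n + 1) k'

section Discrimination

variable {A : Type u} {B : Type v} [Fintype A] [Fintype B]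

/-- The state of `R_n B_n` after all calls, when the unknown channel is `N`. -/
def SeqStrategy.finalState (N : QChannel A B) :
    {n k : ℕ} → SeqStrategy A B n k → Matrix (Fin k × B) (Fin k × B) ℂ
  | _, _, .start ρ => ampliate N.toLin ρ.mat
  | _, _, .step S T => ampliate N.toLin (T.toLin (S.finalState N))

variable [DecidableEq B]

/-- An `(n, m)` protocol: a strategy with `n` calls, and a collective test on `m` copies of its
final system `R_n B_n`. The outcome `Λ` is the guess that the channel is the first one. -/
structure RepProtocol (A : Type u) (B : Type v) [Fintype A] [Fintype B] [DecidableEq B]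
    (n m : ℕ) where
  refDim : ℕ
  strategy : SeqStrategy A B n refDim
  test : QTest (Fin m → Fin refDim × B)

/-- Type I error probability: rejecting although the channel is `N`. -/
def RepProtocol.typeI {n m : ℕ} (P : RepProtocol A B n m) (N : QChannel A B) : ℝ :=
  (Matrix.trace ((1 - P.test.op) * tensorPow m (P.strategy.finalState N))).re

/-- Type II error probability: accepting although the channel is `M`. -/
def RepProtocol.typeII {n m : ℕ} (P : RepProtocol A B n m) (M : QChannel A B) : ℝ :=
  (Matrix.trace (P.test.op * tensorPow m (P.strategy.finalState M))).re

/-- The error exponent `-(1/(nm)) ln x` of a number `x ∈ [0, ∞]`; it is `+∞` at `x = 0`. -/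
def errExponent (n m : ℕ) (x : ℝ≥0∞) : EReal :=
  -(((1 / ((n : ℝ) * (m : ℝ)) : ℝ) : EReal) * ENNReal.log x)

/-- The optimal expected error probability of `(n, m)` protocols, with prior `(p, 1 - p)`. -/
def optError (p : ℝ) (N M : QChannel A B) (n m : ℕ) : ℝ≥0∞ :=
  ⨅ P : RepProtocol A B n m, ENNReal.ofReal (p * P.typeI N + (1 - p) * P.typeII M)

/-- The non-asymptotic Chernoff exponent `ξ_{n,m}(p, N, M)`. -/
def chernoffExp (p : ℝ) (N M : QChannel A B) (n m : ℕ) : EReal :=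
  errExponent n m (optError p N M n m)

/-- The non-asymptotic Hoeffding exponent `B_{n,m}(r, N, M)`. -/
def hoeffdingExp (r : ℝ) (N M : QChannel A B) (n m : ℕ) : EReal :=
  ⨆ (P : RepProtocol A B n m)
    (_ : (r : EReal) ≤ errExponent n m (ENNReal.ofReal (P.typeII M))),
    errExponent n m (ENNReal.ofReal (P.typeI N))

end Discrimination

end ChannelDiscrimination

end

namespace ChannelDiscrimination

universe u v

/-! ### Overlap of product measures with bounded log-likelihood ratio -/

section Classical

variable {Y : Type*} [Fintype Y]

/-! The geometric Rényi divergence is the classical Rényi divergence of the best simultaneous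
decomposition, and this reduces the problem to classical testing. For positive definite matrices
write `σ = W W*` and `ρ = W diag(l) W*`. The rescaled columns of `W` express both matrices as
combinations of the same rank-one matrices, with weights `1 - u` and `u`; the choice does not depend
on `α`. Applied to Choi matrices (`exists_channelDecomposition`), this gives completely positive
maps `Φ_x` with `N = ∑ (1 - u_x) Φ_x` and `M = ∑ u_x Φ_x`. A bound `D̂_α(N‖M) ≤ d` then becomes `∑
(1 - u_x)^α u_x^(1-α) Tr Φ_x(ψ) ≥ e^{(α-1)d} Tr ψ` for every positive semidefinite `ψ`.

Because this inequality holds for all inputs, it multiplies along an adaptive strategy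
(`exists_strategy_decomposition`): the two final states are mixtures of common positive operators
with weights `P` and `Q`, and the sum of `P^α Q^(1-α)` against the traces is at least the `n`-th
power of the one-call bound. Where both weights are positive, `|log (P/Q)|` is at most `n` times a
constant of the channels, whatever the reference dimensions.

Any test on `m` copies has weighted error at least the overlap of the two `m`-fold product weights.
Exponential tilting at the minimiser of the moment generating function, with a variance bound,
bounds the overlap below by the Chernoff exponent with a loss of only `O(√m)` in the exponent
(`sum_prod_mul_min_ge`). For fixed `n` the loss is uniform over protocols and disappears as `m → ∞`.
The result is `RepProtocol.exp_le_typeI_add`; equal weighting of the errors gives the Chernoff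
bound, and an exponential weight adapted to `r` gives the Hoeffding bound. -/

theorem sum_prod_pi {R : Type*} [CommSemiring R] {m : ℕ} (f : Fin m → Y → R) :
    ∑ y : Fin m → Y, ∏ j, f j (y j) = ∏ j, ∑ x, f j x := by
  classical
  rw [Finset.prod_univ_sum, Fintype.piFinset_univ]

theorem sum_pi_cons {m : ℕ} (F : (Fin (m + 1) → Y) → ℝ) :
    ∑ y, F y = ∑ x : Y, ∑ y : Fin m → Y, F (Fin.cons x y) := by
  rw [← (Fin.consEquiv fun _ : Fin (m + 1) => Y).sum_comp, Fintype.sum_prod_type]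
  rfl

theorem sum_prod_mul_sum {p f : Y → ℝ} (hp : ∑ x, p x = 1) (hf : ∑ x, p x * f x = 0) (m : ℕ) :
    ∑ y : Fin m → Y, (∏ j, p (y j)) * ∑ j, f (y j) = 0 := by
  induction m with
  | zero => simp
  | succ m ih =>
    have h1 : ∑ y : Fin m → Y, ∏ j, p (y j) = 1 := by simp [sum_prod_pi, hp]
    rw [sum_pi_cons]
    simp only [Fin.prod_univ_succ, Fin.sum_univ_succ, Fin.cons_zero, Fin.cons_succ]
    have : ∀ x : Y, ∑ y : Fin m → Y, p x * (∏ j, p (y j)) * (f x + ∑ j, f (y j)) = p x * f x := by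
      intro x
      calc _ = p x * f x * ∑ y : Fin m → Y, (∏ j, p (y j))
            + p x * ∑ y : Fin m → Y, (∏ j, p (y j)) * ∑ j, f (y j) := by
            rw [Finset.mul_sum, Finset.mul_sum, ← Finset.sum_add_distrib]
            exact Finset.sum_congr rfl fun y _ => by ring
        _ = _ := by rw [h1, ih]; ring
    simp only [this, hf]

/-- The variance of a sum of independent centred variables. -/
theorem sum_prod_mul_sum_sq {p f : Y → ℝ} (hp : ∑ x, p x = 1) (hf : ∑ x, p x * f x = 0) (m : ℕ) :
    ∑ y : Fin m → Y, (∏ j, p (y j)) * (∑ j, f (y j)) ^ 2 = m * ∑ x, p x * f x ^ 2 := by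
  induction m with
  | zero => simp
  | succ m ih =>
    have h1 : ∑ y : Fin m → Y, ∏ j, p (y j) = 1 := by simp [sum_prod_pi, hp]
    have h2 := sum_prod_mul_sum hp hf m
    rw [sum_pi_cons]
    simp only [Fin.prod_univ_succ, Fin.sum_univ_succ, Fin.cons_zero, Fin.cons_succ]
    have : ∀ x : Y, ∑ y : Fin m → Y, p x * (∏ j, p (y j)) * (f x + ∑ j, f (y j)) ^ 2
        = p x * f x ^ 2 + p x * (m * ∑ x, p x * f x ^ 2) := by
      intro x
      calc _ = p x * f x ^ 2 * ∑ y : Fin m → Y, (∏ j, p (y j))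
            + 2 * p x * f x * ∑ y : Fin m → Y, (∏ j, p (y j)) * ∑ j, f (y j)
            + p x * ∑ y : Fin m → Y, (∏ j, p (y j)) * (∑ j, f (y j)) ^ 2 := by
            rw [Finset.mul_sum, Finset.mul_sum, Finset.mul_sum, ← Finset.sum_add_distrib,
              ← Finset.sum_add_distrib]
            exact Finset.sum_congr rfl fun y _ => by ring
        _ = _ := by rw [h1, h2, ih]; ring
    simp only [this, Finset.sum_add_distrib, ← Finset.sum_mul, hp]
    push_cast; ring

/-- First-order conditions at a minimiser of the moment generating function on `[0, 1]`. -/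
theorem exists_tilt {q l : Y → ℝ} :
    ∃ α ∈ Set.Icc (0 : ℝ) 1,
      α * ∑ x, q x * Real.exp (α * l x) * l x ≤ 0 ∧
      0 ≤ (1 - α) * ∑ x, q x * Real.exp (α * l x) * l x := by
  let Z : ℝ → ℝ := fun s => ∑ x, q x * Real.exp (s * l x)
  have hZc : Continuous Z := by fun_prop
  obtain ⟨α, hα, hmin⟩ := isCompact_Icc.exists_isMinOn (Set.nonempty_Icc.2 zero_le_one)
    hZc.continuousOn
  -- At a minimiser over `[0, 1]` the derivative along the segment towards any `t` is nonnegative;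
  -- `t = 0` and `t = 1` give the two conditions, also when `α` is an endpoint.
  have hd : ∀ t ∈ Set.Icc (0 : ℝ) 1, 0 ≤ (t - α) * ∑ x, q x * Real.exp (α * l x) * l x := by
    intro t ht
    have hder : HasDerivAt (fun s => Z (α + s * (t - α)))
        ((t - α) * ∑ x, q x * Real.exp (α * l x) * l x) 0 := by
      rw [Finset.mul_sum]
      refine HasDerivAt.fun_sum fun x _ => ?_
      have h1 : HasDerivAt (fun s : ℝ => (α + s * (t - α)) * l x) ((t - α) * l x) 0 := by
        simpa using ((((hasDerivAt_id (0 : ℝ)).mul_const (t - α)).const_add α).mul_const (l x))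
      have h2 := (h1.exp).const_mul (q x)
      refine h2.congr_deriv ?_
      simp only [zero_mul, add_zero]; ring
    refine ge_of_tendsto hder.tendsto_slope_zero_right ?_
    filter_upwards [Ioo_mem_nhdsGT (zero_lt_one' ℝ)] with s hs
    have : α + s * (t - α) ∈ Set.Icc (0 : ℝ) 1 := by
      have := (convex_Icc (0 : ℝ) 1) hα ht (a := 1 - s) (b := s) (by linarith [hs.2]) hs.1.le
        (by ring)
      convert this using 1
      simp only [smul_eq_mul]; ring
    have := isMinOn_iff.1 hmin _ this
    simp only [zero_add, zero_mul, add_zero, smul_eq_mul]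
    exact mul_nonneg (inv_nonneg.2 hs.1.le) (sub_nonneg.2 this)
  refine ⟨α, hα, ?_, hd 1 ⟨zero_le_one, le_rfl⟩⟩
  have := hd 0 ⟨le_rfl, zero_le_one⟩
  linarith

/-- A dimension-free lower bound for the overlap of two product measures with bounded
log-likelihood ratio. -/
theorem sum_prod_mul_min_ge {q l : Y → ℝ} {K G : ℝ} (hq : ∀ x, 0 ≤ q x) (hl : ∀ x, |l x| ≤ K)
    (hG : ∀ α ∈ Set.Icc (0 : ℝ) 1, Real.exp G ≤ ∑ x, q x * Real.exp (α * l x)) (m : ℕ) :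
    Real.exp (m * G - K * √m)
      ≤ ∑ y : Fin m → Y, (∏ j, q (y j)) * min (Real.exp (∑ j, l (y j))) 1 := by
  obtain ⟨α, hα, h0, h1⟩ := exists_tilt (q := q) (l := l)
  set Z := ∑ x, q x * Real.exp (α * l x) with hZ
  have hZG : Real.exp G ≤ Z := hG α hα
  have hZpos : 0 < Z := (Real.exp_pos _).trans_le hZG
  -- The tilted probability. The first-order conditions say that its mean `μ` of `l` has `α μ ≤ 0 ≤
  -- (1 - α) μ`.
  let p : Y → ℝ := fun x => q x * Real.exp (α * l x) / Z
  have hp0 : ∀ x, 0 ≤ p x := fun x => by have := hq x; positivity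
  have hp1 : ∑ x, p x = 1 := by
    simp only [p, ← Finset.sum_div, ← hZ]; exact div_self hZpos.ne'
  set μ := ∑ x, p x * l x with hμ
  have hμZ : μ = (∑ x, q x * Real.exp (α * l x) * l x) / Z := by
    rw [hμ, Finset.sum_div]
    exact Finset.sum_congr rfl fun x _ => by simp only [p]; ring
  have hμ0 : α * μ ≤ 0 := by
    rw [hμZ, ← mul_div_assoc]; exact div_nonpos_of_nonpos_of_nonneg h0 hZpos.le
  have hμ1 : 0 ≤ (1 - α) * μ := by
    rw [hμZ, ← mul_div_assoc]; exact div_nonneg h1 hZpos.le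
  let f : Y → ℝ := fun x => l x - μ
  have hf0 : ∑ x, p x * f x = 0 := by
    simp only [f, mul_sub, Finset.sum_sub_distrib, ← Finset.sum_mul, hp1, ← hμ]; ring
  have hK : 0 ≤ K ∨ IsEmpty Y := by
    rcases isEmpty_or_nonempty Y with h | ⟨⟨x⟩⟩
    · exact .inr h
    · exact .inl ((abs_nonneg _).trans (hl x))
  have hK : 0 ≤ K := by
    refine hK.resolve_right fun h => ?_
    simp at hp1
  have hfK : ∑ x, p x * f x ^ 2 ≤ K ^ 2 := by
    have e1 : ∑ x, p x * f x ^ 2 = ∑ x, p x * l x ^ 2 - μ ^ 2 := by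
      have : ∀ x, p x * f x ^ 2 = p x * l x ^ 2 - 2 * μ * (p x * l x) + μ ^ 2 * p x := fun x => by
        simp only [f]; ring
      simp only [this, Finset.sum_add_distrib, Finset.sum_sub_distrib, ← Finset.mul_sum, hp1, ← hμ]
      ring
    have e2 : ∑ x, p x * l x ^ 2 ≤ ∑ x, p x * K ^ 2 :=
      Finset.sum_le_sum fun x _ => mul_le_mul_of_nonneg_left
        (sq_le_sq' (abs_le.1 (hl x)).1 (abs_le.1 (hl x)).2) (hp0 x)
    rw [← Finset.sum_mul, hp1, one_mul] at e2
    nlinarith [sq_nonneg μ]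
  let w : (Fin m → Y) → ℝ := fun y => ∏ j, p (y j)
  let X : (Fin m → Y) → ℝ := fun y => ∑ j, f (y j)
  have hw0 : ∀ y, 0 ≤ w y := fun y => Finset.prod_nonneg fun j _ => hp0 _
  have hw1 : ∑ y, w y = 1 := by simp [w, sum_prod_pi, hp1]
  -- The second moment is `m` times a variance at most `K²`; no cardinality of `Y` enters.
  have hEX : ∑ y, w y * |X y| ≤ K * √m := by
    have e1 := Real.pow_arith_mean_le_arith_mean_pow Finset.univ w (fun y => |X y|)
      (fun y _ => hw0 y) hw1 (fun y _ => abs_nonneg _) 2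
    simp only [sq_abs] at e1
    have e2 : ∑ y, w y * X y ^ 2 = m * ∑ x, p x * f x ^ 2 := sum_prod_mul_sum_sq hp1 hf0 m
    refine abs_le_of_sq_le_sq' (e1.trans ?_) (by positivity) |>.2
    rw [e2, mul_pow, Real.sq_sqrt (Nat.cast_nonneg m), mul_comm]
    exact mul_le_mul_of_nonneg_right hfK (Nat.cast_nonneg m)
  have hJ : Real.exp (-(K * √m)) ≤ ∑ y, w y * Real.exp (-|X y|) := by
    have := convexOn_exp.map_sum_le (t := Finset.univ) (w := w) (p := fun y => -|X y|)
      (fun y _ => hw0 y) hw1 (fun y _ => Set.mem_univ _)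
    simp only [smul_eq_mul, mul_neg, Finset.sum_neg_distrib] at this
    exact (Real.exp_le_exp.2 (neg_le_neg hEX)).trans this
  -- With `S = X + mμ`, the signs of `α μ` and `(1 - α) μ` give `αS - |X| ≤ min S 0`.
  have hterm : ∀ y, Z ^ m * (w y * Real.exp (-|X y|))
      ≤ (∏ j, q (y j)) * min (Real.exp (∑ j, l (y j))) 1 := by
    intro y
    set S := ∑ j, l (y j) with hS
    have hXS : X y = S - m * μ := by simp [X, f, hS]
    have hwZ : Z ^ m * w y = (∏ j, q (y j)) * Real.exp (α * S) := by
      simp only [w, p, Finset.prod_div_distrib, Finset.prod_const, Finset.card_univ,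
        Fintype.card_fin, Finset.prod_mul_distrib, ← Real.exp_sum, ← Finset.mul_sum, ← hS]
      field_simp
    rw [← mul_assoc, hwZ, mul_assoc]
    refine mul_le_mul_of_nonneg_left ?_ (Finset.prod_nonneg fun j _ => hq _)
    rw [← Real.exp_add]
    have hm : (0 : ℝ) ≤ m := Nat.cast_nonneg m
    have a1 := abs_le.1 (le_refl |X y|)
    rw [hXS] at a1 ⊢
    have b1 := mul_le_mul_of_nonneg_left hμ0 hm
    have b2 := mul_nonneg hm hμ1
    have b3 := abs_nonneg (S - m * μ)
    refine le_min (Real.exp_le_exp.2 ?_) (Real.exp_le_one_iff.2 ?_)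
    · nlinarith [hα.1, hα.2]
    · nlinarith [hα.1, hα.2]
  calc Real.exp (m * G - K * √m) = Real.exp G ^ m * Real.exp (-(K * √m)) := by
        rw [← Real.exp_nat_mul, ← Real.exp_add]; congr 1
    _ ≤ Z ^ m * ∑ y, w y * Real.exp (-|X y|) := by gcongr
    _ ≤ _ := by
        rw [Finset.mul_sum]; exact Finset.sum_le_sum fun y _ => hterm y

end Classical

/-! ### Operator powers and weighted geometric means -/

section CStar

variable {A : Type*} [CStarAlgebra A] [PartialOrder A] [StarOrderedRing A]

theorem rpow_conj_unitary (V : unitary A) {X : A} (hX : IsStrictlyPositive X) (s : ℝ) :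
    ((V : A) * X * star (V : A)) ^ s = (V : A) * X ^ s * star (V : A) := by
  have h0 : 0 ≤ (V : A) * X * star (V : A) := star_right_conjugate_nonneg hX.nonneg _
  rw [CFC.rpow_eq_cfc_real h0, CFC.rpow_eq_cfc_real hX.nonneg]
  have hc : ContinuousOn (fun x : ℝ => x ^ s) (spectrum ℝ X) :=
    ContinuousOn.rpow_const continuousOn_id fun x hx => .inl (hX.spectrum_pos hx).ne'
  have hcont : Continuous (Unitary.conjStarAlgAut ℝ A V) := by
    have : ⇑(Unitary.conjStarAlgAut ℝ A V) = fun x => (V : A) * x * star (V : A) := by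
      ext x; exact Unitary.conjStarAlgAut_apply V x
    rw [this]; fun_prop
  have := StarAlgHomClass.map_cfc (Unitary.conjStarAlgAut ℝ A V) (fun x : ℝ => x ^ s) X hc hcont
  simpa [Unitary.conjStarAlgAut_apply] using this.symm

/-- `(T T*)^s = T (T* T)^(s-1) T*` for invertible `T`. -/
theorem rpow_mul_star_self {T : A} (hT : IsUnit T) (s : ℝ) :
    (T * star T) ^ s = T * (star T * T) ^ (s - 1) * star T := by
  have hX : IsStrictlyPositive (star T * T) := by
    rw [IsStrictlyPositive.iff_of_unital]
    exact ⟨star_mul_self_nonneg T, hT.star.mul hT⟩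
  set X := star T * T with hXdef
  have hadd : ∀ a b : ℝ, X ^ a * X ^ b = X ^ (a + b) := fun a b => (CFC.rpow_add hX.isUnit).symm
  have hone : X ^ (1 : ℝ) = X := CFC.rpow_one X hX.nonneg
  have hzero : X ^ (0 : ℝ) = 1 := CFC.rpow_zero X hX.nonneg
  have hsa : ∀ a : ℝ, star (X ^ a) = X ^ a := fun a =>
    (IsSelfAdjoint.of_nonneg CFC.rpow_nonneg).star_eq
  have hY : X ^ (-1 / 2 : ℝ) * X * X ^ (-1 / 2 : ℝ) = 1 := by
    nth_rewrite 2 [← hone]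
    rw [hadd, hadd, ← hzero]; norm_num
  -- `T * Y` is the unitary factor of the polar decomposition of `T`, and it conjugates `T* T` into
  -- `T T*`.
  let Y := X ^ (-1 / 2 : ℝ)
  have hYs : star Y = Y := hsa _
  have hV1 : star (T * Y) * (T * Y) = 1 := by
    calc star (T * Y) * (T * Y) = Y * X * Y := by
          rw [star_mul, hYs, hXdef]; simp only [mul_assoc]
      _ = 1 := hY
  have hVu : IsUnit (T * Y) := hT.mul (hX.rpow _ _).isUnit
  have hV2 : (T * Y) * star (T * Y) = 1 := by
    obtain ⟨u, hu⟩ := hVu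
    rw [← hu] at hV1 ⊢
    have : star (u : A) = ((u⁻¹ : Aˣ) : A) := Units.eq_inv_of_mul_eq_one_right hV1
    rw [this]; simp
  let V : unitary A := ⟨T * Y, Unitary.mem_iff.2 ⟨hV1, hV2⟩⟩
  have h1 : T * star T = (V : A) * X * star (V : A) := by
    change _ = T * Y * X * star (T * Y)
    have : T * Y * X * star (T * Y) = T * (Y * X * Y) * star T := by
      rw [star_mul, hYs]; simp only [mul_assoc]
    rw [this, hY, mul_one]
  rw [h1, rpow_conj_unitary V hX]
  change T * Y * X ^ s * star (T * Y) = _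
  have : T * Y * X ^ s * star (T * Y) = T * (Y * X ^ s * Y) * star T := by
    rw [star_mul, hYs]; simp only [mul_assoc]
  rw [this, hadd, hadd]
  congr 3; ring

theorem rpow_neg_anti {a b : A} (ha : IsStrictlyPositive a) (hab : a ≤ b) {p : ℝ}
    (hp : p ∈ Set.Ioc (0 : ℝ) 1) : b ^ (-p) ≤ a ^ (-p) := by
  have hb : IsStrictlyPositive b := IsStrictlyPositive.of_le ha hab
  rw [← CFC.inverse_rpow a p hp.1.ne', ← CFC.inverse_rpow b p hp.1.ne']
  exact CStarAlgebra.antitoneOn_ringInverse (ha.rpow _ _) (hb.rpow _ _)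
    (CFC.rpow_le_rpow ⟨hp.1.le, hp.2⟩ hab)

/-- A Hansen-type inequality for an expansion `D`. By monotonicity of `x^α` it is enough to bound
`(T T*)^α = T (T* T)^(α-1) T*` for `T = D L^(1/2)`. Since `D* D ≥ 1`, one has `T* T ≥ L`, and the
power `α - 1 ∈ (-1, 0)` reverses operator order. -/
theorem rpow_le_conj_rpow {α : ℝ} (hα : α ∈ Set.Ioo (0 : ℝ) 1) {M D L : A} (hD : IsUnit D)
    (hL : IsStrictlyPositive L) (hDD : 1 ≤ D * star D) (hM : M ≤ D * L * star D) :
    M ^ α ≤ D * L ^ α * star D := by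
  refine (CFC.rpow_le_rpow ⟨hα.1.le, hα.2.le⟩ hM).trans ?_
  have hadd : ∀ a b : ℝ, L ^ a * L ^ b = L ^ (a + b) := fun a b => (CFC.rpow_add hL.isUnit).symm
  have hone : L ^ (1 : ℝ) = L := CFC.rpow_one L hL.nonneg
  have hsa : ∀ a : ℝ, star (L ^ a) = L ^ a := fun a =>
    (IsSelfAdjoint.of_nonneg CFC.rpow_nonneg).star_eq
  have hDD' : 1 ≤ star D * D := by
    have hst : IsStrictlyPositive (D * star D) := by
      rw [IsStrictlyPositive.iff_of_unital]
      exact ⟨mul_star_self_nonneg D, hD.mul hD.star⟩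
    have h1 := CStarAlgebra.ringInverse_le_ringInverse (a := (1 : A)) (b := D * star D) hDD
      (by exact isStrictlyPositive_one)
    rw [Ring.inverse_one] at h1
    have h2 := star_left_conjugate_le_conjugate h1 D
    have h3 : star D * Ring.inverse (D * star D) * D = 1 := by
      obtain ⟨u, rfl⟩ := hD
      have : (u : A) * star (u : A) = ((u * star u : Aˣ) : A) := by simp
      rw [this, Ring.inverse_unit, mul_inv_rev, Units.val_mul, mul_assoc, mul_assoc,
        Units.inv_mul, mul_one, ← Units.coe_star, Units.mul_inv]
    rw [h3] at h2
    simpa using h2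
  set s := L ^ (1 / 2 : ℝ) with hs
  have hs1 : star s = s := hsa _
  have hss : s * s = L := by rw [hs, hadd]; norm_num [hone]
  have e1 : D * L * star D = (D * s) * star (D * s) := by
    rw [star_mul, hs1]; nth_rewrite 1 [← hss]; simp only [mul_assoc]
  have hTu : IsUnit (D * s) := hD.mul (hL.rpow _ _).isUnit
  rw [e1, rpow_mul_star_self hTu]
  have h4 : L ≤ star (D * s) * (D * s) := by
    have := star_left_conjugate_le_conjugate hDD' s
    rw [mul_one, hs1, hss] at this
    rw [star_mul, hs1]; simpa only [mul_assoc] using this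
  have h5 := rpow_neg_anti hL h4 (p := 1 - α) ⟨by linarith [hα.2], by linarith [hα.1]⟩
  rw [neg_sub] at h5
  refine (star_right_conjugate_le_conjugate h5 (D * s)).trans (le_of_eq ?_)
  have : D * s * L ^ (α - 1) * star (D * s) = D * (s * L ^ (α - 1) * s) * star D := by
    rw [star_mul, hs1]; simp only [mul_assoc]
  rw [this, hs, hadd, hadd]
  congr 3; ring

/-- Upper bound on the weighted geometric mean by a simultaneous decomposition. -/
theorem geometricMean_le {α : ℝ} (hα : α ∈ Set.Ioo (0 : ℝ) 1) {ρ σ W L : A} (hW : IsUnit W)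
    (hL : IsStrictlyPositive L) (hσ : IsStrictlyPositive σ) (hσW : σ ≤ W * star W)
    (hρW : ρ ≤ W * L * star W) :
    σ ^ (1 / 2 : ℝ) * (σ ^ (-1 / 2 : ℝ) * ρ * σ ^ (-1 / 2 : ℝ)) ^ α * σ ^ (1 / 2 : ℝ)
      ≤ W * L ^ α * star W := by
  have hadd : ∀ a b : ℝ, σ ^ a * σ ^ b = σ ^ (a + b) := fun a b => (CFC.rpow_add hσ.isUnit).symm
  have hone : σ ^ (1 : ℝ) = σ := CFC.rpow_one σ hσ.nonneg
  have hzero : σ ^ (0 : ℝ) = 1 := CFC.rpow_zero σ hσ.nonneg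
  have hsa : ∀ a : ℝ, star (σ ^ a) = σ ^ a := fun a =>
    (IsSelfAdjoint.of_nonneg CFC.rpow_nonneg).star_eq
  set r := σ ^ (-1 / 2 : ℝ) with hr
  set s := σ ^ (1 / 2 : ℝ) with hs
  have hr1 : star r = r := hsa _
  have hs1 : star s = s := hsa _
  have hsr : s * r = 1 := by rw [hs, hr, hadd, ← hzero]; norm_num
  have hrσ : r * σ * r = 1 := by
    nth_rewrite 1 [← hone]
    rw [hr, hadd, hadd, ← hzero]; norm_num
  -- The expansion inequality is applied to `D = σ^(-1/2) W`; `σ ≤ W W*` says exactly that `D D* ≥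
  -- 1`.
  have h1 : 1 ≤ (r * W) * star (r * W) := by
    have := star_right_conjugate_le_conjugate hσW r
    rw [hr1, hrσ] at this
    rw [star_mul, hr1]; simpa only [mul_assoc] using this
  have h2 : r * ρ * r ≤ (r * W) * L * star (r * W) := by
    have := star_right_conjugate_le_conjugate hρW r
    rw [hr1] at this
    rw [star_mul, hr1]; simpa only [mul_assoc] using this
  have h3 := rpow_le_conj_rpow hα ((hσ.rpow _ _).isUnit.mul hW) hL h1 h2
  have h4 := star_right_conjugate_le_conjugate h3 s
  rw [hs1] at h4
  refine h4.trans (le_of_eq ?_)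
  have hrs : r * s = 1 := by rw [hs, hr, hadd, ← hzero]; norm_num
  calc s * (r * W * L ^ α * star (r * W)) * s
      = (s * r) * W * L ^ α * star W * (r * s) := by
        rw [star_mul, hr1]; simp only [mul_assoc]
    _ = _ := by rw [hsr, hrs]; simp

end CStar

/-! ### Geometric means of matrices and simultaneous diagonalisation -/

section MatrixMean

open scoped MatrixOrder Matrix.Norms.L2Operator

variable {ι : Type*} [Fintype ι] [DecidableEq ι]

theorem matPow_eq_rpow {X : Matrix ι ι ℂ} (hX : X.PosSemidef) (s : ℝ) : matPow X s = X ^ s :=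
  (CFC.rpow_eq_cfc_real (Matrix.nonneg_iff_posSemidef.2 hX)).symm

theorem diagonal_rpow {l : ι → ℝ} (hl : ∀ x, 0 < l x) (s : ℝ) :
    (Matrix.diagonal fun x => (l x : ℂ)) ^ s = Matrix.diagonal fun x => ((l x ^ s : ℝ) : ℂ) := by
  have hD : 0 ≤ (Matrix.diagonal fun x => (l x : ℂ)) :=
    Matrix.nonneg_iff_posSemidef.2 (Matrix.PosSemidef.diagonal fun x => by simpa using (hl x).le)
  -- A polynomial equal to the power at the values of `l`, which contain the spectrum; polynomials
  -- act entrywise on diagonal matrices.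
  let p : Polynomial ℝ := Lagrange.interpolate (Finset.univ.image l) id fun t => t ^ s
  have hp : ∀ x, p.eval (l x) = l x ^ s := fun x =>
    Lagrange.eval_interpolate_at_node (fun t : ℝ => t ^ s) (Function.injective_id.injOn)
      (Finset.mem_image_of_mem l (Finset.mem_univ x))
  have hmap : ∀ q : Polynomial ℝ, Polynomial.aeval (Matrix.diagonal fun x => (l x : ℂ)) q
      = Matrix.diagonal fun x => ((q.eval (l x) : ℝ) : ℂ) := by
    intro q
    have h1 := Polynomial.aeval_algHom_apply (Matrix.diagonalAlgHom ℝ) (fun x => (l x : ℂ)) q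
    have h2 : Polynomial.aeval (fun x => (l x : ℂ)) q = fun x => ((q.eval (l x) : ℝ) : ℂ) := by
      funext x
      have := Polynomial.aeval_algHom_apply (Pi.evalAlgHom ℝ (fun _ : ι => ℂ) x)
        (fun x => (l x : ℂ)) q
      exact this.symm.trans (Polynomial.aeval_ofReal q (l x))
    rw [h2] at h1
    exact h1
  rw [CFC.rpow_eq_cfc_real hD, cfc_congr (g := p.eval), cfc_polynomial p _ (IsSelfAdjoint.of_nonneg hD),
    hmap]
  · simp only [hp]
  · intro t ht
    by_contra hne
    have hx : ∀ x, l x ≠ t := by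
      rintro x rfl
      exact hne (hp x).symm
    refine ht ?_
    have hu : IsUnit (fun x => ((t - l x : ℝ) : ℂ)) := by
      refine Pi.isUnit_iff.2 fun x => ?_
      exact (Complex.ofReal_ne_zero.2 (sub_ne_zero.2 (hx x).symm)).isUnit
    have := hu.map (Matrix.diagonalAlgHom ℝ)
    rw [spectrum.mem_resolventSet_iff]
    convert this using 1
    ext i j
    by_cases hij : i = j <;> simp [hij, Matrix.algebraMap_matrix_apply, Matrix.diagonal]

theorem geomQuasiReg_le {α : ℝ} (hα : α ∈ Set.Ioo (0 : ℝ) 1) {ρ σ W : Matrix ι ι ℂ} {l : ι → ℝ}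
    {ε : ℝ} (hε : 0 < ε) (hW : IsUnit W) (hl : ∀ x, 0 < l x) (hσ : σ.PosSemidef)
    (hρ : ρ.PosSemidef)
    (hσW : (W * star W - (σ + (ε : ℂ) • (1 : Matrix ι ι ℂ))).PosSemidef)
    (hρW : (W * Matrix.diagonal (fun x => (l x : ℂ)) * star W - ρ).PosSemidef) :
    geomQuasiReg α ρ σ ε
      ≤ (Matrix.trace (W * Matrix.diagonal (fun x => ((l x ^ α : ℝ) : ℂ)) * star W)).re := by
  set τ := σ + (ε : ℂ) • (1 : Matrix ι ι ℂ) with hτ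
  have hτp : τ.PosDef := by
    refine Matrix.PosDef.posSemidef_add hσ ?_
    exact Matrix.PosDef.one.smul (by exact_mod_cast hε)
  have hτs : IsStrictlyPositive τ := Matrix.isStrictlyPositive_iff_posDef.2 hτp
  have hL : IsStrictlyPositive (Matrix.diagonal fun x => (l x : ℂ)) :=
    Matrix.isStrictlyPositive_iff_posDef.2 (Matrix.PosDef.diagonal fun x => by simpa using hl x)
  have key := geometricMean_le hα hW hL hτs (Matrix.le_iff.2 hσW) (Matrix.le_iff.2 hρW)
  rw [diagonal_rpow hl] at key
  have hsa : star (τ ^ (-1 / 2 : ℝ)) = τ ^ (-1 / 2 : ℝ) :=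
    (IsSelfAdjoint.of_nonneg CFC.rpow_nonneg).star_eq
  have hmid : (τ ^ (-1 / 2 : ℝ) * ρ * τ ^ (-1 / 2 : ℝ)).PosSemidef := by
    have := hρ.mul_mul_conjTranspose_same (τ ^ (-1 / 2 : ℝ))
    rwa [← Matrix.star_eq_conjTranspose, hsa] at this
  have hnn := (Matrix.le_iff.1 key).trace_nonneg
  rw [Matrix.trace_sub, sub_nonneg] at hnn
  have hre := (Complex.le_def.1 hnn).1
  refine le_trans (le_of_eq ?_) hre
  simp only [geomQuasiReg, ← hτ]
  rw [matPow_eq_rpow hτp.posSemidef, matPow_eq_rpow hmid]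
  rw [Matrix.trace_mul_cycle, ← CFC.rpow_add hτs.isUnit]
  have : τ ^ (1 / 2 + 1 / 2 : ℝ) = τ := by
    rw [show (1 / 2 + 1 / 2 : ℝ) = 1 by norm_num]; exact CFC.rpow_one τ hτs.nonneg
  rw [this]

/-- Write `σ = b* b` and diagonalise `(b⁻¹)* ρ b⁻¹` by a unitary `U`; then `W = b* U` works. -/
theorem exists_simultaneous_decomposition {ρ σ : Matrix ι ι ℂ} (hρ : ρ.PosDef) (hσ : σ.PosDef) :
    ∃ (W : Matrix ι ι ℂ) (l : ι → ℝ), IsUnit W ∧ (∀ x, 0 < l x) ∧ σ = W * star W ∧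
      ρ = W * Matrix.diagonal (fun x => (l x : ℂ)) * star W := by
  obtain ⟨B, hB, hBσ⟩ := (CStarAlgebra.isStrictlyPositive_iff_eq_star_mul_self).1
    (Matrix.isStrictlyPositive_iff_posDef.2 hσ)
  obtain ⟨b, rfl⟩ := hB
  let X : Matrix ι ι ℂ := star ((b⁻¹ : (Matrix ι ι ℂ)ˣ) : Matrix ι ι ℂ) * ρ *
    ((b⁻¹ : (Matrix ι ι ℂ)ˣ) : Matrix ι ι ℂ)
  have hX : X.PosDef := (Matrix.IsUnit.posDef_star_left_conjugate_iff (b⁻¹).isUnit).2 hρ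
  have hspec := hX.1.spectral_theorem
  set U := hX.1.eigenvectorUnitary
  rw [Unitary.conjStarAlgAut_apply] at hspec
  refine ⟨star (b : Matrix ι ι ℂ) * (U : Matrix ι ι ℂ), hX.1.eigenvalues, ?_,
    hX.eigenvalues_pos, ?_, ?_⟩
  · exact b.isUnit.star.mul (Unitary.toUnits U).isUnit
  · rw [star_mul, star_star, mul_assoc, ← mul_assoc (U : Matrix ι ι ℂ),
      Unitary.mul_star_self_of_mem U.2, one_mul, hBσ]
  · have h1 : ρ = star (b : Matrix ι ι ℂ) * X * b := by
      simp only [X, mul_assoc, Units.inv_mul, mul_one]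
      rw [← mul_assoc, ← star_mul, Units.inv_mul, star_one, one_mul]
    rw [star_mul, star_star]
    calc ρ = star (b : Matrix ι ι ℂ) * X * (b : Matrix ι ι ℂ) := h1
      _ = star (b : Matrix ι ι ℂ) * ((U : Matrix ι ι ℂ) *
          Matrix.diagonal (RCLike.ofReal ∘ hX.1.eigenvalues) * star (U : Matrix ι ι ℂ)) * (b : Matrix ι ι ℂ) :=
        congrArg (fun Z => star (b : Matrix ι ι ℂ) * Z * (b : Matrix ι ι ℂ)) hspec
      _ = _ := by
        simp only [mul_assoc]
        rfl

end MatrixMean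

/-- The weight `(1 - u)^α u^(1 - α)` of the geometric mean. -/
noncomputable def meanWeight (α u : ℝ) : ℝ := (1 - u) ^ α * u ^ (1 - α)

theorem continuous_meanWeight {α : ℝ} (hα : α ∈ Set.Ioo (0 : ℝ) 1) : Continuous (meanWeight α) := by
  have h1 : Continuous fun u : ℝ => (1 - u) ^ α :=
    (continuous_const.sub continuous_id).rpow_const fun _ => .inr hα.1.le
  have h2 : Continuous fun u : ℝ => u ^ (1 - α) :=
    continuous_id.rpow_const fun _ => .inr (by linarith [hα.2])
  exact h1.mul h2

theorem meanWeight_nonneg (α : ℝ) {u : ℝ} (hu : u ∈ Set.Icc (0 : ℝ) 1) : 0 ≤ meanWeight α u :=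
  mul_nonneg (Real.rpow_nonneg (by linarith [hu.2]) _) (Real.rpow_nonneg hu.1 _)

theorem meanWeight_inv_one_add (α : ℝ) {l : ℝ} (hl : 0 < l) :
    meanWeight α (1 / (1 + l)) * (1 + l) = l ^ α := by
  have h1 : (0 : ℝ) < 1 + l := by linarith
  have h2 : 1 - 1 / (1 + l) = l / (1 + l) := by field_simp; ring
  have h3 : (1 + l) ^ α * (1 + l) ^ (1 - α) = 1 + l := by
    rw [← Real.rpow_add h1]; simp
  have h4 : (0 : ℝ) < (1 + l) ^ α := Real.rpow_pos_of_pos h1 _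
  have h5 : (0 : ℝ) < (1 + l) ^ (1 - α) := Real.rpow_pos_of_pos h1 _
  rw [meanWeight, h2, Real.div_rpow hl.le h1.le, Real.div_rpow zero_le_one h1.le, Real.one_rpow]
  field_simp
  linear_combination -h3

/-! ### Common rank-one decompositions, optimal for every order -/

section Decomposition

open scoped MatrixOrder Matrix.Norms.L2Operator in
theorem exists_smul_one_le {ι : Type*} [Fintype ι] [DecidableEq ι] {X : Matrix ι ι ℂ}
    (hX : X.PosDef) : ∃ c : ℝ, 0 < c ∧ (X - (c : ℂ) • (1 : Matrix ι ι ℂ)).PosSemidef := by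
  rcases isEmpty_or_nonempty ι with h | h
  · exact ⟨1, one_pos, by rw [Subsingleton.elim (X - _) 0]; exact Matrix.PosSemidef.zero⟩
  have hs : IsStrictlyPositive X := Matrix.isStrictlyPositive_iff_posDef.2 hX
  obtain ⟨c, hc, hle⟩ := (CFC.exists_pos_algebraMap_le_iff (a := X) hs.isSelfAdjoint).2
    fun x hx => hs.spectrum_pos hx
  refine ⟨c, hc, ?_⟩
  have := Matrix.le_iff.1 hle
  have e : (c : ℂ) • (1 : Matrix ι ι ℂ) = algebraMap ℝ (Matrix ι ι ℂ) c := by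
    ext i j
    by_cases hij : i = j <;> simp [hij, Matrix.algebraMap_matrix_apply]
  rw [e]; exact this

variable {κ : Type*} [Fintype κ] [DecidableEq κ]

theorem mul_diagonal_mul_star {ι : Type*} (V : Matrix ι κ ℂ) (d : κ → ℂ) :
    V * Matrix.diagonal d * V.conjTranspose
      = ∑ x, d x • Matrix.vecMulVec (fun i => V i x) (star fun i => V i x) := by
  ext i j
  simp [Matrix.mul_apply, Matrix.diagonal_apply, Matrix.sum_apply, Matrix.vecMulVec_apply]
  exact Finset.sum_congr rfl fun x _ => by ring

omit [DecidableEq κ] in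
theorem mul_vecMulVec_mul_conjTranspose {ι : Type*} (V : Matrix ι κ ℂ) (t : κ → ℂ) :
    V * Matrix.vecMulVec t (star t) * V.conjTranspose
      = Matrix.vecMulVec (V.mulVec t) (star (V.mulVec t)) := by
  rw [Matrix.mul_vecMulVec, Matrix.vecMulVec_mul, Matrix.star_mulVec]

omit [Fintype κ] in
theorem posDef_add_smul_one {ρ : Matrix κ κ ℂ} (hρ : ρ.PosSemidef) {δ : ℝ} (hδ : 0 < δ) :
    (ρ + (δ : ℂ) • (1 : Matrix κ κ ℂ)).PosDef :=
  Matrix.PosDef.posSemidef_add hρ (Matrix.PosDef.one.smul (by exact_mod_cast hδ))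

/-- Regularising by `δ` before the conjugation absorbs regularising by `ε` after it: `δ V V* ≥ δ c 1
≥ ε 1` once `ε < δ c`. The equivalence `e` only serves to make `V W` square. -/
theorem geomQuasiReg_conj_eventually_le {ι : Type*} [Fintype ι] [DecidableEq ι] (e : ι ≃ κ)
    {α : ℝ} (hα : α ∈ Set.Ioo (0 : ℝ) 1) {ρ σ W : Matrix κ κ ℂ} {l : κ → ℝ} {δ : ℝ} (hδ : 0 < δ)
    (hρ : ρ.PosSemidef) (hσ : σ.PosSemidef) (hW : IsUnit W) (hl : ∀ x, 0 < l x)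
    (hσW : σ + (δ : ℂ) • (1 : Matrix κ κ ℂ) = W * star W)
    (hρW : ρ + (δ : ℂ) • (1 : Matrix κ κ ℂ) = W * Matrix.diagonal (fun x => (l x : ℂ)) * star W)
    {V : Matrix ι κ ℂ} {V' : Matrix κ ι ℂ} (hV : V * V' = 1) :
    ∀ᶠ ε in 𝓝[>] (0 : ℝ), geomQuasiReg α (V * ρ * V.conjTranspose) (V * σ * V.conjTranspose) ε
      ≤ (Matrix.trace (V * (W * Matrix.diagonal (fun x => ((l x ^ α : ℝ) : ℂ)) * star W)
          * V.conjTranspose)).re := by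
  have hVV : (V * V.conjTranspose).PosDef := by
    refine Matrix.PosDef.mul_conjTranspose_self V fun v w hvw => ?_
    have := congrArg (fun z => Matrix.vecMul z V') hvw
    simpa [Matrix.vecMul_vecMul, hV] using this
  obtain ⟨c, hc, hcV⟩ := exists_smul_one_le hVV
  obtain ⟨Wu, rfl⟩ := hW
  set W : Matrix κ κ ℂ := (Wu : Matrix κ κ ℂ)
  let W' : Matrix ι ι ℂ := (V * W).submatrix id e
  have hdiag : ∀ d : κ → ℂ, W' * Matrix.diagonal (d ∘ e) * star W'
      = V * (W * Matrix.diagonal d * star W) * V.conjTranspose := by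
    intro d
    rw [Matrix.star_eq_conjTranspose, Matrix.conjTranspose_submatrix,
      ← Matrix.submatrix_diagonal_equiv, Matrix.submatrix_mul_equiv, Matrix.submatrix_mul_equiv,
      Matrix.submatrix_id_id, Matrix.conjTranspose_mul, Matrix.star_eq_conjTranspose]
    simp only [Matrix.mul_assoc]
  have hone : W' * star W' = V * (W * star W) * V.conjTranspose := by
    have := hdiag fun _ => 1
    have h1 : Matrix.diagonal (fun _ : κ => (1 : ℂ)) = 1 := Matrix.diagonal_one
    have h2 : Matrix.diagonal ((fun _ : κ => (1 : ℂ)) ∘ e) = 1 := Matrix.diagonal_one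
    rwa [h1, h2, Matrix.mul_one, Matrix.mul_one] at this
  have hW' : IsUnit W' := by
    have : W' * ((((Wu⁻¹ : (Matrix κ κ ℂ)ˣ) : Matrix κ κ ℂ) * V').submatrix e id) = 1 := by
      rw [Matrix.submatrix_mul_equiv, Matrix.mul_assoc, ← Matrix.mul_assoc W,
        Units.mul_inv, Matrix.one_mul, hV, Matrix.submatrix_id_id]
    exact IsUnit.of_mul_eq_one _ this
  filter_upwards [Ioo_mem_nhdsGT (mul_pos hδ hc)] with ε hε
  have key := geomQuasiReg_le hα (ρ := V * ρ * V.conjTranspose) (σ := V * σ * V.conjTranspose)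
    (W := W') (l := l ∘ e) hε.1 hW' (fun x => hl _) (hσ.mul_mul_conjTranspose_same V)
    (hρ.mul_mul_conjTranspose_same V) ?_ ?_
  · refine key.trans (le_of_eq ?_)
    have := hdiag fun x => ((l x ^ α : ℝ) : ℂ)
    rw [← this]; rfl
  · rw [hone, ← hσW, Matrix.mul_add, Matrix.add_mul, add_sub_add_left_eq_sub]
    have h1 : V * (δ : ℂ) • (1 : Matrix κ κ ℂ) * V.conjTranspose - (ε : ℂ) • (1 : Matrix ι ι ℂ)
        = (δ : ℂ) • (V * V.conjTranspose - (c : ℂ) • (1 : Matrix ι ι ℂ))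
          + ((δ * c - ε : ℝ) : ℂ) • (1 : Matrix ι ι ℂ) := by
      rw [Matrix.mul_smul, Matrix.mul_one, Matrix.smul_mul, smul_sub, smul_smul]
      push_cast
      rw [sub_smul]; abel
    rw [h1]
    refine (hcV.smul (by exact_mod_cast hδ.le)).add (Matrix.PosSemidef.one.smul ?_)
    exact_mod_cast (sub_pos.2 hε.2).le
  · have h1 := hdiag fun x => (l x : ℂ)
    have h2 : (fun x => (((l ∘ e) x : ℝ) : ℂ)) = (fun x => (l x : ℂ)) ∘ e := rfl
    rw [h2, h1, ← hρW, Matrix.mul_add, Matrix.add_mul, add_sub_cancel_left]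
    rw [Matrix.mul_smul, Matrix.mul_one, Matrix.smul_mul]
    exact hVV.posSemidef.smul (by exact_mod_cast hδ.le)

theorem trace_vecMulVec_star_re {ι : Type*} [Fintype ι] (v : ι → ℂ) :
    (Matrix.trace (Matrix.vecMulVec v (star v))).re = ∑ i, Complex.normSq (v i) := by
  simp [Matrix.trace, Matrix.vecMulVec_apply, Complex.mul_conj]

theorem exists_decomposition_of_pos {ρ σ : Matrix κ κ ℂ} (hρ : ρ.PosSemidef) (hσ : σ.PosSemidef)
    {δ : ℝ} (hδ : 0 < δ) :
    ∃ (u : κ → ℝ) (t : κ → κ → ℂ), (∀ x, u x ∈ Set.Icc (0 : ℝ) 1) ∧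
      ρ + (δ : ℂ) • (1 : Matrix κ κ ℂ)
        = ∑ x, ((1 - u x : ℝ) : ℂ) • Matrix.vecMulVec (t x) (star (t x)) ∧
      σ + (δ : ℂ) • (1 : Matrix κ κ ℂ)
        = ∑ x, ((u x : ℝ) : ℂ) • Matrix.vecMulVec (t x) (star (t x)) ∧
      ∀ α ∈ Set.Ioo (0 : ℝ) 1, ∀ {ι : Type v} [Fintype ι] [DecidableEq ι] (_ : ι ≃ κ)
        (V : Matrix ι κ ℂ) (V' : Matrix κ ι ℂ), V * V' = 1 →
        ∀ᶠ ε in 𝓝[>] (0 : ℝ),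
          geomQuasiReg α (V * ρ * V.conjTranspose) (V * σ * V.conjTranspose) ε
            ≤ ∑ x, meanWeight α (u x) * ∑ i, Complex.normSq (V.mulVec (t x) i) := by
  obtain ⟨W, l, hW, hl, hσW, hρW⟩ := exists_simultaneous_decomposition
    (posDef_add_smul_one hρ hδ) (posDef_add_smul_one hσ hδ)
  -- The factor `√(1 + l)` turns the weights `l` and `1` into `l / (1 + l)` and `1 / (1 + l)`, which
  -- add up to one and so stay in a compact set as `δ → 0`.
  let t : κ → κ → ℂ := fun x i => (√(1 + l x) : ℂ) * W i x
  have hl1 : ∀ x, 0 < 1 + l x := fun x => by linarith [hl x]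
  have hvec : ∀ x, Matrix.vecMulVec (t x) (star (t x))
      = ((1 + l x : ℝ) : ℂ) • Matrix.vecMulVec (fun i => W i x) (star fun i => W i x) := by
    intro x
    ext i j
    have : (√(1 + l x) : ℂ) * (√(1 + l x) : ℂ) = ((1 + l x : ℝ) : ℂ) := by
      rw [← Complex.ofReal_mul, Real.mul_self_sqrt (hl1 x).le]
    simp only [Matrix.vecMulVec_apply, t, Matrix.smul_apply, Pi.star_apply, star_mul',
      RCLike.star_def, Complex.conj_ofReal, smul_eq_mul]
    rw [← this]; ring
  have hdiag : ∀ d : κ → ℝ, W * Matrix.diagonal (fun x => (d x : ℂ)) * star W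
      = ∑ x, ((d x / (1 + l x) : ℝ) : ℂ) • Matrix.vecMulVec (t x) (star (t x)) := by
    intro d
    rw [Matrix.star_eq_conjTranspose, mul_diagonal_mul_star]
    refine Finset.sum_congr rfl fun x _ => ?_
    rw [hvec, smul_smul, ← Complex.ofReal_mul, div_mul_cancel₀ _ (hl1 x).ne']
  refine ⟨fun x => 1 / (1 + l x), t, fun x => ⟨by have := hl1 x; positivity, ?_⟩, ?_, ?_, ?_⟩
  · rw [div_le_one (hl1 x)]; linarith [hl x]
  · rw [hρW, hdiag]
    refine Finset.sum_congr rfl fun x _ => ?_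
    congr 2
    have := (hl1 x).ne'
    field_simp; ring
  · have h1 : Matrix.diagonal (fun _ : κ => ((1 : ℝ) : ℂ)) = 1 := by simp
    have h2 := hdiag fun _ => 1
    rw [h1, Matrix.mul_one] at h2
    rw [hσW, h2]
  · intro α hα ι _ _ e V V' hV
    filter_upwards [geomQuasiReg_conj_eventually_le e hα hδ hρ hσ hW hl hσW hρW hV] with ε hε
    refine hε.trans (le_of_eq ?_)
    rw [hdiag, Matrix.mul_sum, Matrix.sum_mul, Matrix.trace_sum, Complex.re_sum]
    refine Finset.sum_congr rfl fun x _ => ?_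
    rw [Matrix.mul_smul, Matrix.smul_mul, mul_vecMulVec_mul_conjTranspose, Matrix.trace_smul,
      smul_eq_mul, Complex.re_ofReal_mul, trace_vecMulVec_star_re,
      ← meanWeight_inv_one_add α (hl x), mul_div_cancel_right₀ _ (hl1 x).ne']

end Decomposition

section Decomposition

variable {κ : Type*} [Fintype κ] [DecidableEq κ]

omit [Fintype κ] in
theorem eq_of_tendsto_add_smul_one {P : Type*} [TopologicalSpace P] {F : P → Matrix κ κ ℂ}
    (hF : Continuous F) {p : ℕ → P} {p' : P} (hp : Tendsto p atTop (𝓝 p')) {δ : ℕ → ℝ}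
    (hδ : Tendsto δ atTop (𝓝 0)) {Z : Matrix κ κ ℂ}
    (h : ∀ k, Z + (δ k : ℂ) • (1 : Matrix κ κ ℂ) = F (p k)) : Z = F p' := by
  have h1 : Tendsto (fun k => (δ k : ℂ)) atTop (𝓝 0) := by
    have := (Complex.continuous_ofReal.tendsto 0).comp hδ
    simpa [Function.comp_def] using this
  have h2 : Tendsto (fun k => Z + (δ k : ℂ) • (1 : Matrix κ κ ℂ)) atTop (𝓝 Z) := by
    have := (h1.smul_const (1 : Matrix κ κ ℂ)).const_add Z
    simpa using this
  simp only [h] at h2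
  exact tendsto_nhds_unique h2 ((hF.tendsto p').comp hp)

/-- Every pair of positive semidefinite matrices is a pair of nonnegative combinations of common
rank-one matrices that is optimal for all geometric Rényi quasi-entropies at once. -/
theorem exists_decomposition {ρ σ : Matrix κ κ ℂ} (hρ : ρ.PosSemidef) (hσ : σ.PosSemidef) :
    ∃ (u : κ → ℝ) (t : κ → κ → ℂ), (∀ x, u x ∈ Set.Icc (0 : ℝ) 1) ∧
      ρ = ∑ x, ((1 - u x : ℝ) : ℂ) • Matrix.vecMulVec (t x) (star (t x)) ∧
      σ = ∑ x, ((u x : ℝ) : ℂ) • Matrix.vecMulVec (t x) (star (t x)) ∧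
      ∀ α ∈ Set.Ioo (0 : ℝ) 1, ∀ {ι : Type v} [Fintype ι] [DecidableEq ι] (_ : ι ≃ κ)
        (V : Matrix ι κ ℂ) (V' : Matrix κ ι ℂ), V * V' = 1 →
        geomQuasi α (V * ρ * V.conjTranspose) (V * σ * V.conjTranspose)
          ≤ ENNReal.ofReal (∑ x, meanWeight α (u x) * ∑ i, Complex.normSq (V.mulVec (t x) i)) := by
  let δ : ℕ → ℝ := fun k => 1 / ((k : ℝ) + 1)
  have hδ : ∀ k, 0 < δ k := fun k => by positivity
  have hδ1 : ∀ k, δ k ≤ 1 := fun k => by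
    have : (0 : ℝ) ≤ k := Nat.cast_nonneg k
    exact (div_le_one (by positivity)).2 (by linarith)
  have hδ0 : Tendsto δ atTop (𝓝 0) := tendsto_one_div_add_atTop_nhds_zero_nat
  choose u t hu hut hst hV using fun k =>
    exists_decomposition_of_pos.{v} (ρ := ρ) (σ := σ) hρ hσ (hδ k)
  -- The diagonal entries of the two decompositions give `‖t x i‖² ≤ C`, with `2δ ≤ 2`; as `C ≥ 1`,
  -- also `‖t x i‖ ≤ C`.
  let C : ℝ := 3 + ∑ i, (‖ρ i i‖ + ‖σ i i‖)
  have hsum0 : 0 ≤ ∑ i, (‖ρ i i‖ + ‖σ i i‖) :=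
    Finset.sum_nonneg fun i _ => by positivity
  have hC : ∀ k x i, ‖t k x i‖ ≤ C := by
    intro k x i
    have h1 : ∑ x, Complex.normSq (t k x i) = (ρ i i).re + (σ i i).re + 2 * δ k := by
      have e1 := congrArg (fun Z => (Z i i).re) (hut k)
      have e2 := congrArg (fun Z => (Z i i).re) (hst k)
      simp only [Matrix.add_apply, Matrix.smul_apply, Matrix.one_apply_eq, Matrix.sum_apply,
        Matrix.vecMulVec_apply, Pi.star_apply, smul_eq_mul, mul_one, Complex.add_re,
        Complex.ofReal_re, RCLike.star_def, Complex.mul_conj, Complex.re_sum,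
        ← Complex.ofReal_mul] at e1 e2
      have e3 : ∑ x, Complex.normSq (t k x i) = ∑ x, (1 - u k x) * Complex.normSq (t k x i)
          + ∑ x, u k x * Complex.normSq (t k x i) := by
        rw [← Finset.sum_add_distrib]
        exact Finset.sum_congr rfl fun x _ => by ring
      rw [e3, ← e1, ← e2]; ring
    have h2 : Complex.normSq (t k x i) ≤ ∑ x, Complex.normSq (t k x i) :=
      Finset.single_le_sum (f := fun x => Complex.normSq (t k x i))
        (fun x _ => Complex.normSq_nonneg _) (Finset.mem_univ x)
    have h3 : ‖ρ i i‖ + ‖σ i i‖ ≤ ∑ i, (‖ρ i i‖ + ‖σ i i‖) :=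
      Finset.single_le_sum (f := fun i => ‖ρ i i‖ + ‖σ i i‖)
        (fun i _ => by positivity) (Finset.mem_univ i)
    have h4 := Complex.re_le_norm (ρ i i)
    have h5 := Complex.re_le_norm (σ i i)
    have h6 : ‖t k x i‖ ^ 2 ≤ C := by
      rw [← Complex.normSq_eq_norm_sq]
      simp only [C]
      linarith [hδ1 k]
    have hC1 : 1 ≤ C := by simp only [C]; linarith
    nlinarith [norm_nonneg (t k x i)]
  have hC0 : 0 ≤ C := by simp only [C]; linarith
  let S : Set ((κ → ℝ) × (κ → κ → ℂ)) := Set.Icc 0 1 ×ˢ Metric.closedBall 0 C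
  have hS : IsCompact S := isCompact_Icc.prod (isCompact_closedBall _ _)
  have hmem : ∀ k, (u k, t k) ∈ S := fun k => by
    refine ⟨⟨fun x => (hu k x).1, fun x => (hu k x).2⟩, ?_⟩
    rw [mem_closedBall_zero_iff]
    exact (pi_norm_le_iff_of_nonneg hC0).2 fun x => (pi_norm_le_iff_of_nonneg hC0).2 fun i =>
      hC k x i
  obtain ⟨⟨u', t'⟩, hmem', φ, hφ, hlim⟩ := hS.tendsto_subseq hmem
  have hδφ : Tendsto (fun k => δ (φ k)) atTop (𝓝 0) := hδ0.comp hφ.tendsto_atTop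
  have hcontvec : ∀ x, Continuous fun p : (κ → ℝ) × (κ → κ → ℂ) =>
      Matrix.vecMulVec (p.2 x) (star (p.2 x)) := fun x => by
    refine continuous_matrix fun i j => ?_
    simp only [Matrix.vecMulVec_apply, Pi.star_apply]
    fun_prop
  refine ⟨u', t', fun x => ⟨hmem'.1.1 x, hmem'.1.2 x⟩, ?_, ?_, ?_⟩
  · refine eq_of_tendsto_add_smul_one (F := fun p : (κ → ℝ) × (κ → κ → ℂ) =>
      ∑ x, ((1 - p.1 x : ℝ) : ℂ) • Matrix.vecMulVec (p.2 x) (star (p.2 x))) ?_ hlim hδφ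
      fun k => hut (φ k)
    exact continuous_finsetSum _ fun x _ => (Complex.continuous_ofReal.comp (by fun_prop)).smul
        (hcontvec x)
  · refine eq_of_tendsto_add_smul_one (F := fun p : (κ → ℝ) × (κ → κ → ℂ) =>
      ∑ x, ((p.1 x : ℝ) : ℂ) • Matrix.vecMulVec (p.2 x) (star (p.2 x))) ?_ hlim hδφ
      fun k => hst (φ k)
    exact continuous_finsetSum _ fun x _ => (Complex.continuous_ofReal.comp (by fun_prop)).smul
        (hcontvec x)
  · intro α hα ι _ _ e V V' hVV
    have hc : Continuous fun p : (κ → ℝ) × (κ → κ → ℂ) =>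
        ENNReal.ofReal (∑ x, meanWeight α (p.1 x) *
          ∑ i, Complex.normSq (V.mulVec (p.2 x) i)) := by
      refine ENNReal.continuous_ofReal.comp (continuous_finsetSum _ fun x _ => ?_)
      refine Continuous.mul ((continuous_meanWeight hα).comp (by fun_prop))
        (continuous_finsetSum _ fun i _ => ?_)
      refine Complex.continuous_normSq.comp ?_
      simp only [Matrix.mulVec, dotProduct]
      fun_prop
    -- For each `k` the left side, which does not involve `δ`, is bounded by the `k`-th sum;
    -- `meanWeight α` is continuous also at `u = 0` and `u = 1`, so the bound passes to the limit.
    refine ge_of_tendsto ((hc.tendsto (u', t')).comp hlim) (Eventually.of_forall fun k => ?_)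
    refine limsup_le_of_le (by isBoundedDefault) ?_
    filter_upwards [hV (φ k) α hα e V V' hVV] with ε hε
    exact ENNReal.ofReal_le_ofReal hε

end Decomposition

/-! ### Choi matrices and reference systems -/

section Choi

variable {R : Type*} {A : Type u} {B : Type v}

/-- The Choi matrix of a linear map. -/
def choi [DecidableEq A] (Φ : Matrix A A ℂ →ₗ[ℂ] Matrix B B ℂ) : Matrix (A × B) (A × B) ℂ :=
  Matrix.of fun p q => Φ (Matrix.single p.1 q.1 1) p.2 q.2

/-- The linear map with a given Choi matrix. -/
noncomputable def ofChoi [Fintype A] (T : Matrix (A × B) (A × B) ℂ) :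
    Matrix A A ℂ →ₗ[ℂ] Matrix B B ℂ where
  toFun X := Matrix.of fun b b' => ∑ a, ∑ a', X a a' * T (a, b) (a', b')
  map_add' X X' := by
    ext b b'; simp [add_mul, Finset.sum_add_distrib]
  map_smul' c X := by
    ext b b'; simp [mul_assoc, Finset.mul_sum]

theorem ofChoi_apply [Fintype A] (T : Matrix (A × B) (A × B) ℂ) (X : Matrix A A ℂ) (b b' : B) :
    ofChoi T X b b' = ∑ a, ∑ a', X a a' * T (a, b) (a', b') := rfl

theorem ofChoi_choi [Fintype A] [DecidableEq A] (Φ : Matrix A A ℂ →ₗ[ℂ] Matrix B B ℂ) :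
    ofChoi (choi Φ) = Φ := by
  refine LinearMap.ext fun X => ?_
  ext b b'
  conv_rhs => rw [Matrix.matrix_eq_sum_single X]
  simp only [ofChoi_apply, choi, Matrix.of_apply, map_sum, Matrix.sum_apply]
  refine Finset.sum_congr rfl fun a _ => Finset.sum_congr rfl fun a' _ => ?_
  have : Matrix.single a a' (X a a') = X a a' • Matrix.single a a' (1 : ℂ) := by simp
  rw [this, map_smul, Matrix.smul_apply, smul_eq_mul]

theorem ofChoi_sum_smul [Fintype A] {κ : Type*} [Fintype κ] (c : κ → ℂ)
    (T : κ → Matrix (A × B) (A × B) ℂ) :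
    ofChoi (∑ x, c x • T x) = ∑ x, c x • ofChoi (T x) := by
  refine LinearMap.ext fun X => ?_
  ext b b'
  simp only [ofChoi_apply, LinearMap.sum_apply, LinearMap.smul_apply, Matrix.sum_apply,
    Matrix.smul_apply, smul_eq_mul, Finset.mul_sum]
  conv_rhs => rw [Finset.sum_comm]
  refine Finset.sum_congr rfl fun a _ => ?_
  conv_rhs => rw [Finset.sum_comm]
  exact Finset.sum_congr rfl fun a' _ => Finset.sum_congr rfl fun x _ => by ring

theorem ampliate_sum_smul {κ : Type*} [Fintype κ] (c : κ → ℂ)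
    (Φ : κ → Matrix A A ℂ →ₗ[ℂ] Matrix B B ℂ) (X : Matrix (R × A) (R × A) ℂ) :
    ampliate (∑ x, c x • Φ x) X = ∑ x, c x • ampliate (Φ x) X := by
  ext p q
  simp [ampliate, Matrix.sum_apply]

theorem ampliate_ofChoi_posSemidef [Fintype R] [DecidableEq R] [Fintype A] [Fintype B]
    (t : A × B → ℂ) {X : Matrix (R × A) (R × A) ℂ} (hX : X.PosSemidef) :
    (ampliate (ofChoi (Matrix.vecMulVec t (star t))) X).PosSemidef := by
  let L : Matrix (R × B) (R × A) ℂ := Matrix.of fun p q => if p.1 = q.1 then t (q.2, p.2) else 0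
  have : ampliate (ofChoi (Matrix.vecMulVec t (star t))) X = L * X * L.conjTranspose := by
    ext p q
    simp only [ampliate, ofChoi_apply, Matrix.of_apply, Matrix.vecMulVec_apply, Pi.star_apply,
      Matrix.mul_apply, Matrix.conjTranspose_apply, L, Fintype.sum_prod_type, ite_mul, zero_mul,
      apply_ite star, star_zero, mul_ite, mul_zero, Finset.sum_ite_irrel, Finset.sum_const_zero,
      Finset.sum_ite_eq, Finset.mem_univ, if_true]
    rw [Finset.sum_comm]
    simp only [Finset.sum_mul]
    exact Finset.sum_congr rfl fun a _ => Finset.sum_congr rfl fun a' _ => by ring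
  rw [this]
  exact hX.mul_mul_conjTranspose_same L

/-- On a pure input the output is the Choi matrix conjugated by `V`, the operator `K ⊗ 1` with `K`
read as a matrix from `A` to `R`. This turns the bounds for conjugated Choi matrices into bounds for
channel outputs. -/
theorem ampliate_ofChoi_vecMulVec [Fintype A] [Fintype B] [DecidableEq B]
    (T : Matrix (A × B) (A × B) ℂ) (K : R × A → ℂ) :
    let V : Matrix (R × B) (A × B) ℂ := Matrix.of fun p q => if p.2 = q.2 then K (p.1, q.1) else 0
    ampliate (ofChoi T) (Matrix.vecMulVec K (star K)) = V * T * V.conjTranspose := by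
  intro V
  ext p q
  simp only [ampliate, ofChoi_apply, Matrix.of_apply, Matrix.vecMulVec_apply, Pi.star_apply,
      Matrix.mul_apply, Matrix.conjTranspose_apply, V, Fintype.sum_prod_type, ite_mul, zero_mul,
      apply_ite star, star_zero, mul_ite, mul_zero,
      Finset.sum_ite_eq, Finset.mem_univ, if_true]
  rw [Finset.sum_comm]
  simp only [Finset.sum_mul]
  exact Finset.sum_congr rfl fun a _ => Finset.sum_congr rfl fun a' _ => by ring

/-- The marginal on the second system. -/
def marginal [Fintype R] (X : Matrix (R × A) (R × A) ℂ) : Matrix A A ℂ :=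
  ∑ r, X.submatrix (fun a => (r, a)) (fun a => (r, a))

theorem marginal_posSemidef [Fintype R] {X : Matrix (R × A) (R × A) ℂ} (hX : X.PosSemidef) :
    (marginal X).PosSemidef :=
  Matrix.posSemidef_sum _ fun _ _ => hX.submatrix _

theorem trace_marginal [Fintype R] [Fintype A] (X : Matrix (R × A) (R × A) ℂ) :
    (marginal X).trace = X.trace := by
  rw [marginal, Matrix.trace_sum]
  simp [Matrix.trace, Fintype.sum_prod_type]

theorem trace_ampliate [Fintype R] [Fintype B] (Φ : Matrix A A ℂ →ₗ[ℂ] Matrix B B ℂ)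
    (X : Matrix (R × A) (R × A) ℂ) : (ampliate Φ X).trace = (Φ (marginal X)).trace := by
  simp only [marginal, map_sum, Matrix.trace_sum]
  simp only [Matrix.trace, Fintype.sum_prod_type]
  rfl

variable [Fintype A] [Fintype B]

theorem choi_posSemidef [DecidableEq A] (N : QChannel A B) : (choi N.toLin).PosSemidef := by
  let e := Fintype.equivFin A
  let K : Fin (Fintype.card A) × A → ℂ := fun p => if p.1 = e p.2 then 1 else 0
  have h := N.completelyPositive _ _ (Matrix.posSemidef_vecMulVec_self_star K)
  have : choi N.toLin = (ampliate N.toLin (Matrix.vecMulVec K (star K))).submatrix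
      (fun p => (e p.1, p.2)) (fun p => (e p.1, p.2)) := by
    ext p q
    simp only [choi, ampliate, Matrix.of_apply, Matrix.submatrix_apply]
    refine congrArg (fun Z => N.toLin Z p.2 q.2) ?_
    ext x y
    simp [K, Matrix.single_apply, Matrix.vecMulVec_apply, ← ite_and, and_comm]
  rw [this]
  exact h.submatrix _

end Choi

theorem log_ofReal_exp (x : ℝ) : ENNReal.log (ENNReal.ofReal (Real.exp x)) = x := by
  have h := Real.exp_pos x
  rw [ENNReal.log_pos_real (by simpa using h) ENNReal.ofReal_ne_top,
    ENNReal.toReal_ofReal h.le, Real.log_exp]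

/-- The quasi-entropy is bounded below by a bound on the relative entropy. -/
theorem exp_le_of_geomRenyi_le {ι : Type*} [Fintype ι] [DecidableEq ι] {α d F : ℝ}
    (hα : α ∈ Set.Ioo (0 : ℝ) 1) {ρ σ : Matrix ι ι ℂ} (hd : geomRenyi α ρ σ ≤ d)
    (hF : geomQuasi α ρ σ ≤ ENNReal.ofReal F) : Real.exp ((α - 1) * d) ≤ F := by
  by_contra hlt
  rw [not_le] at hlt
  have hα1 : α - 1 < 0 := by linarith [hα.2]
  have h1 : geomQuasi α ρ σ < ENNReal.ofReal (Real.exp ((α - 1) * d)) :=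
    hF.trans_lt ((ENNReal.ofReal_lt_ofReal_iff (Real.exp_pos _)).2 hlt)
  have h2 := ENNReal.log_strictMono h1
  rw [log_ofReal_exp] at h2
  rw [geomRenyi] at hd
  have hneg : 1 / (α - 1) < 0 := one_div_neg.2 hα1
  induction hx : ENNReal.log (geomQuasi α ρ σ) with
  | bot =>
    rw [hx, EReal.coe_mul_bot_of_neg hneg] at hd
    exact absurd hd (by simp)
  | top => rw [hx] at h2; exact absurd h2 (by simp)
  | coe x =>
    rw [hx] at h2 hd
    norm_cast at h2 hd
    have h3 := mul_lt_mul_of_neg_left h2 hneg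
    have h4 : 1 / (α - 1) * ((α - 1) * d) = d := by
      rw [← mul_assoc, one_div_mul_cancel hα1.ne, one_mul]
    rw [h4] at h3
    linarith

/-! ### Common decompositions of two channels -/

section

variable {A : Type u} {B : Type v} [Fintype A] [Fintype B] [DecidableEq B]

/-- A common rank-one decomposition of two channels, with weights `1 - u` and `u`. -/
structure ChannelDecomposition (N M : QChannel A B) where
  u : A × B → ℝ
  t : A × B → A × B → ℂ
  mem_Icc : ∀ x, u x ∈ Set.Icc (0 : ℝ) 1
  left : N.toLin = ∑ x, ((1 - u x : ℝ) : ℂ) • ofChoi (Matrix.vecMulVec (t x) (star (t x)))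
  right : M.toLin = ∑ x, ((u x : ℝ) : ℂ) • ofChoi (Matrix.vecMulVec (t x) (star (t x)))
  bound : ∀ α ∈ Set.Ioo (0 : ℝ) 1, ∀ d : ℝ, geomRenyiChannel α N M ≤ d →
    ∀ ψ : Matrix A A ℂ, ψ.PosSemidef →
      Real.exp ((α - 1) * d) * ψ.trace.re
        ≤ ∑ x, meanWeight α (u x) * (ofChoi (Matrix.vecMulVec (t x) (star (t x))) ψ).trace.re

open scoped MatrixOrder Matrix.Norms.L2Operator in
theorem exists_purification [DecidableEq A] {ψ : Matrix A A ℂ} (hψ : ψ.PosDef) :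
    ∃ b b' : Matrix A A ℂ, b * b' = 1 ∧ ψ = b * b.conjTranspose := by
  obtain ⟨b, hb, h⟩ := CStarAlgebra.isStrictlyPositive_iff_eq_mul_star_self.1
    (Matrix.isStrictlyPositive_iff_posDef.2 hψ)
  obtain ⟨b, rfl⟩ := hb
  exact ⟨b, (b⁻¹ : (Matrix A A ℂ)ˣ), b.mul_inv, h⟩

/-- A full-rank `ψ` has a purification with a reference of dimension `card A`, whose operator `V` is
invertible. The outputs are then conjugates of the Choi matrices, and the squared norm of `V t_x` is
the trace of `Φ_x(ψ)`. -/
theorem exp_le_of_posDef [DecidableEq A] {N M : QChannel A B} {α d : ℝ}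
    (hα : α ∈ Set.Ioo (0 : ℝ) 1) (hd : geomRenyiChannel α N M ≤ d) {u : A × B → ℝ}
    {t : A × B → A × B → ℂ}
    (hV : ∀ {ι : Type v} [Fintype ι] [DecidableEq ι] (_ : ι ≃ A × B)
        (V : Matrix ι (A × B) ℂ) (V' : Matrix (A × B) ι ℂ), V * V' = 1 →
        geomQuasi α (V * choi N.toLin * V.conjTranspose) (V * choi M.toLin * V.conjTranspose)
          ≤ ENNReal.ofReal (∑ x, meanWeight α (u x) * ∑ i, Complex.normSq (V.mulVec (t x) i)))
    {ψ : Matrix A A ℂ} (hψ : ψ.PosDef) (htr : ψ.trace = 1) :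
    Real.exp ((α - 1) * d)
      ≤ ∑ x, meanWeight α (u x) * (ofChoi (Matrix.vecMulVec (t x) (star (t x))) ψ).trace.re := by
  obtain ⟨b, b', hbb, hbψ⟩ := exists_purification hψ
  let e := Fintype.equivFin A
  let K : Fin (Fintype.card A) × A → ℂ := fun p => b p.2 (e.symm p.1)
  have hmarg : marginal (Matrix.vecMulVec K (star K)) = ψ := by
    rw [hbψ]
    ext x y
    simp only [marginal, Matrix.sum_apply, Matrix.submatrix_apply, Matrix.vecMulVec_apply, K,
      Pi.star_apply, Matrix.mul_apply, Matrix.conjTranspose_apply]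
    exact e.symm.sum_comp fun a => b x a * star (b y a)
  let ρ : QState (Fin (Fintype.card A) × A) :=
    ⟨Matrix.vecMulVec K (star K), Matrix.posSemidef_vecMulVec_self_star K, by
      rw [← trace_marginal, hmarg, htr]⟩
  have hρ : geomRenyi α (ampliate N.toLin ρ.mat) (ampliate M.toLin ρ.mat) ≤ d :=
    (le_iSup₂ (f := fun k (ρ : QState (Fin k × A)) =>
      geomRenyi α (ampliate N.toLin ρ.mat) (ampliate M.toLin ρ.mat)) _ ρ).trans hd
  let V : Matrix (Fin (Fintype.card A) × B) (A × B) ℂ :=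
    Matrix.of fun p q => if p.2 = q.2 then K (p.1, q.1) else 0
  have hamp : ∀ T : Matrix (A × B) (A × B) ℂ,
      ampliate (ofChoi T) ρ.mat = V * T * V.conjTranspose :=
    fun T => ampliate_ofChoi_vecMulVec T K
  have hN := hamp (choi N.toLin)
  have hM := hamp (choi M.toLin)
  rw [ofChoi_choi] at hN hM
  let V' : Matrix (A × B) (Fin (Fintype.card A) × B) ℂ :=
    Matrix.of fun q p => if q.2 = p.2 then b' (e.symm p.1) q.1 else 0
  have hVV : V * V' = 1 := by
    have hb' : b' * b = 1 := mul_eq_one_comm.1 hbb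
    ext p q
    have h1 : ∑ a, K (p.1, a) * b' (e.symm q.1) a = if p.1 = q.1 then 1 else 0 := by
      have := congrArg (fun Z => Z (e.symm q.1) (e.symm p.1)) hb'
      simp only [Matrix.mul_apply, Matrix.one_apply, e.symm.injective.eq_iff] at this
      simp only [K]
      simp only [eq_comm (a := p.1), ← this]
      exact Finset.sum_congr rfl fun a _ => mul_comm _ _
    simp only [V, V', Matrix.mul_apply, Matrix.of_apply, Fintype.sum_prod_type, ite_mul, zero_mul,
      mul_ite, mul_zero, Matrix.one_apply, Prod.ext_iff]
    by_cases h2 : p.1 = q.1 <;> by_cases h3 : p.2 = q.2 <;> simp only [h2] at h1 <;>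
      simp [h1, h2, h3]
  have hgeom := hV (e.symm.prodCongr (Equiv.refl B)) V V' hVV
  rw [← hN, ← hM] at hgeom
  have key := exp_le_of_geomRenyi_le hα hρ hgeom
  refine key.trans (le_of_eq (Finset.sum_congr rfl fun x _ => ?_))
  rw [← trace_vecMulVec_star_re, ← mul_vecMulVec_mul_conjTranspose, ← hamp, trace_ampliate, hmarg]

/-- The decomposition is that of the Choi matrices. The bound is homogeneous in `ψ`, so it extends
from full-rank states to positive definite matrices, and then to all positive semidefinite `ψ`
through `ψ + s 1` as `s → 0`. -/
theorem exists_channelDecomposition [DecidableEq A] (N M : QChannel A B) :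
    Nonempty (ChannelDecomposition N M) := by
  obtain ⟨u, t, hu, hN, hM, hV⟩ := exists_decomposition.{v} (choi_posSemidef N) (choi_posSemidef M)
  refine ⟨⟨u, t, hu, ?_, ?_, ?_⟩⟩
  · rw [← ofChoi_sum_smul, ← hN, ofChoi_choi]
  · rw [← ofChoi_sum_smul, ← hM, ofChoi_choi]
  intro α hα d hd ψ hψ
  rcases isEmpty_or_nonempty A with hA | hA
  · simp [Matrix.trace]
  let F : Matrix A A ℂ → ℝ := fun ψ =>
    ∑ x, meanWeight α (u x) * (ofChoi (Matrix.vecMulVec (t x) (star (t x))) ψ).trace.re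
  have hFs : ∀ (c : ℝ) (ψ : Matrix A A ℂ), F ((c : ℂ) • ψ) = c * F ψ := by
    intro c ψ
    simp only [F, map_smul, Matrix.trace_smul, smul_eq_mul, Complex.re_ofReal_mul, Finset.mul_sum]
    exact Finset.sum_congr rfl fun x _ => by ring
  have hFa : ∀ ψ ψ' : Matrix A A ℂ, F (ψ + ψ') = F ψ + F ψ' := by
    intro ψ ψ'
    simp only [F, map_add, Matrix.trace_add, Complex.add_re, mul_add, Finset.sum_add_distrib]
  have hpos : ∀ ψ : Matrix A A ℂ, ψ.PosDef → Real.exp ((α - 1) * d) * ψ.trace.re ≤ F ψ := by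
    intro ψ hψ
    have htr := hψ.trace_pos
    obtain ⟨htr1, htr2⟩ := Complex.pos_iff.1 htr
    have htre : ψ.trace = (ψ.trace.re : ℂ) := Complex.ext rfl (by simp [← htr2])
    have h1 : ((((ψ.trace.re)⁻¹ : ℝ) : ℂ) • ψ).PosDef :=
      hψ.smul (by exact_mod_cast inv_pos.2 htr1)
    have h2 := exp_le_of_posDef hα hd (fun e V V' => hV α hα e V V') h1 (by
      rw [Matrix.trace_smul, smul_eq_mul, htre, ← Complex.ofReal_mul, Complex.ofReal_re,
        inv_mul_cancel₀ htr1.ne', Complex.ofReal_one])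
    have h3 : Real.exp ((α - 1) * d) ≤ (ψ.trace.re)⁻¹ * F ψ := by
      rw [← hFs]; exact h2
    calc _ ≤ (ψ.trace.re)⁻¹ * F ψ * ψ.trace.re := mul_le_mul_of_nonneg_right h3 htr1.le
      _ = F ψ := by field_simp
  have hlim : Tendsto (fun s : ℝ => F ψ + s * F 1
      - Real.exp ((α - 1) * d) * (ψ.trace.re + s * (1 : Matrix A A ℂ).trace.re)) (𝓝[>] 0)
      (𝓝 (F ψ + 0 * F 1
        - Real.exp ((α - 1) * d) * (ψ.trace.re + 0 * (1 : Matrix A A ℂ).trace.re))) :=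
    tendsto_nhdsWithin_of_tendsto_nhds (Continuous.tendsto (by fun_prop) 0)
  have := ge_of_tendsto hlim (b := 0) (by
    filter_upwards [self_mem_nhdsWithin] with s hs
    have := hpos _ (posDef_add_smul_one hψ hs)
    rw [hFa, hFs, Matrix.trace_add, Matrix.trace_smul, smul_eq_mul, Complex.add_re,
      Complex.re_ofReal_mul] at this
    linarith)
  simp only [zero_mul, add_zero] at this
  linarith

end

/-! ### Adaptive strategies -/

section

variable {A : Type u} {B : Type v} [Fintype A] [Fintype B]

theorem QChannel.map_posSemidef (N : QChannel A B) {X : Matrix A A ℂ} (hX : X.PosSemidef) :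
    (N.toLin X).PosSemidef := by
  have h := N.completelyPositive 1 (X.submatrix Prod.snd Prod.snd) (hX.submatrix _)
  exact h.submatrix fun b => (0, b)

omit [Fintype A] [Fintype B] in
theorem ampliate_map_sum_smul {R κ : Type*} [Fintype κ] (c : κ → ℂ)
    (Φ : Matrix A A ℂ →ₗ[ℂ] Matrix B B ℂ) (X : κ → Matrix (R × A) (R × A) ℂ) :
    ampliate Φ (∑ y, c y • X y) = ∑ y, c y • ampliate Φ (X y) := by
  ext p q
  have : (Matrix.of fun x y => (∑ z, c z • X z) (p.1, x) (q.1, y) : Matrix A A ℂ)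
      = ∑ z, c z • Matrix.of fun x y => X z (p.1, x) (q.1, y) := by
    ext x y; simp [Matrix.sum_apply]
  calc _ = Φ (∑ z, c z • Matrix.of fun x y => X z (p.1, x) (q.1, y)) p.2 q.2 :=
        congrArg (fun Z => Φ Z p.2 q.2) this
    _ = _ := by
        simp only [map_sum, map_smul, ampliate, Matrix.of_apply, Matrix.sum_apply,
          Matrix.smul_apply]

variable [DecidableEq B]

/-- The map `Φ_x` of a channel decomposition. -/
noncomputable def ChannelDecomposition.branch {N M : QChannel A B} (D : ChannelDecomposition N M)
    (x : A × B) : Matrix A A ℂ →ₗ[ℂ] Matrix B B ℂ :=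
  ofChoi (Matrix.vecMulVec (D.t x) (star (D.t x)))

/-- `c` is a lower bound on the quasi-entropy of order `α` of a channel decomposition. -/
def ChannelDecomposition.QuasiBound {N M : QChannel A B} (D : ChannelDecomposition N M)
    (α c : ℝ) : Prop :=
  ∀ ψ : Matrix A A ℂ, ψ.PosSemidef →
    c * ψ.trace.re ≤ ∑ x, meanWeight α (D.u x) * (D.branch x ψ).trace.re

/-- Traces of outputs see only the marginal of the input on `A`, so the reference system costs
nothing. -/
theorem ChannelDecomposition.QuasiBound.ampliate {N M : QChannel A B}
    {D : ChannelDecomposition N M} {α c : ℝ} (h : D.QuasiBound α c) {R : Type*} [Fintype R]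
    {X : Matrix (R × A) (R × A) ℂ} (hX : X.PosSemidef) :
    c * X.trace.re
      ≤ ∑ x, meanWeight α (D.u x) * (ChannelDiscrimination.ampliate (D.branch x) X).trace.re := by
  have := h _ (marginal_posSemidef hX)
  rw [trace_marginal] at this
  simpa only [trace_ampliate] using this

/-- The final states of an adaptive strategy are mixtures of common positive semidefinite
operators, with weights inherited from the decomposition of the channels. -/
theorem exists_strategy_decomposition {N M : QChannel A B} (D : ChannelDecomposition N M) {K : ℝ}
    (hK : ∀ x, 0 < 1 - D.u x → 0 < D.u x → |Real.log ((1 - D.u x) / D.u x)| ≤ K)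
    {n k : ℕ} (S : SeqStrategy A B n k) :
    ∃ (Y : Type (max u v)) (_ : Fintype Y) (P Q : Y → ℝ)
      (W : Y → Matrix (Fin k × B) (Fin k × B) ℂ),
      (∀ y, 0 ≤ P y) ∧ (∀ y, 0 ≤ Q y) ∧ (∀ y, (W y).PosSemidef) ∧
      S.finalState N = ∑ y, (P y : ℂ) • W y ∧ S.finalState M = ∑ y, (Q y : ℂ) • W y ∧
      (∀ α c : ℝ, 0 ≤ c → D.QuasiBound α c →
        c ^ n ≤ ∑ y, P y ^ α * Q y ^ (1 - α) * (W y).trace.re) ∧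
      ∀ y, 0 < P y → 0 < Q y → |Real.log (P y / Q y)| ≤ n * K := by
  have hu0 : ∀ x, 0 ≤ D.u x := fun x => (D.mem_Icc x).1
  have hu1 : ∀ x, 0 ≤ 1 - D.u x := fun x => sub_nonneg.2 (D.mem_Icc x).2
  have hN : N.toLin = ∑ x, ((1 - D.u x : ℝ) : ℂ) • D.branch x := D.left
  have hM : M.toLin = ∑ x, ((D.u x : ℝ) : ℂ) • D.branch x := D.right
  induction S with
  | @start k ρ =>
    refine ⟨A × B, inferInstance, fun x => 1 - D.u x, D.u, fun x => ampliate (D.branch x) ρ.mat,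
      hu1, hu0, fun x => ampliate_ofChoi_posSemidef _ ρ.posSemidef, ?_, ?_, ?_, ?_⟩
    · rw [← ampliate_sum_smul, ← hN]; rfl
    · rw [← ampliate_sum_smul, ← hM]; rfl
    · intro α c _ h
      have := h.ampliate ρ.posSemidef
      rw [ρ.trace_eq_one] at this
      simpa [meanWeight] using this
    · simpa using hK
  | @step n k k' S T ih =>
    obtain ⟨Y, _, P, Q, W, hP, hQ, hW, hPW, hQW, hc, hlog⟩ := ih
    have hTW : ∀ y, (T.toLin (W y)).PosSemidef := fun y => T.map_posSemidef (hW y)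
    have hfinal : ∀ (Φ : QChannel A B) (w : A × B → ℝ) (V : Y → ℝ),
        Φ.toLin = ∑ x, (w x : ℂ) • D.branch x → S.finalState Φ = ∑ y, (V y : ℂ) • W y →
        ampliate Φ.toLin (T.toLin (S.finalState Φ))
          = ∑ z : Y × (A × B), ((V z.1 * w z.2 : ℝ) : ℂ) •
            ampliate (D.branch z.2) (T.toLin (W z.1)) := by
      intro Φ w V hΦ hS
      rw [hS, map_sum, hΦ]
      simp only [map_smul]
      rw [ampliate_map_sum_smul]
      conv_rhs => rw [Fintype.sum_prod_type]
      refine Finset.sum_congr rfl fun y _ => ?_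
      rw [ampliate_sum_smul, Finset.smul_sum]
      refine Finset.sum_congr rfl fun x _ => ?_
      rw [smul_smul]; push_cast; rfl
    refine ⟨Y × (A × B), inferInstance, fun z => P z.1 * (1 - D.u z.2), fun z => Q z.1 * D.u z.2,
      fun z => ampliate (D.branch z.2) (T.toLin (W z.1)), fun z => mul_nonneg (hP _) (hu1 _),
      fun z => mul_nonneg (hQ _) (hu0 _), fun z => ampliate_ofChoi_posSemidef _ (hTW _),
      hfinal N _ P hN hPW, hfinal M _ Q hM hQW, ?_, ?_⟩
    -- The next call contributes a factor `c` on every branch separately, since the bound applies to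
    -- each `T (W y)` and `T` preserves its trace.
    · intro α c hc0 h
      calc c ^ (n + 1) = c ^ n * c := pow_succ _ _
        _ ≤ (∑ y, P y ^ α * Q y ^ (1 - α) * (W y).trace.re) * c :=
            mul_le_mul_of_nonneg_right (hc α c hc0 h) hc0
        _ = ∑ y, P y ^ α * Q y ^ (1 - α) * (c * (T.toLin (W y)).trace.re) := by
            rw [Finset.sum_mul]
            exact Finset.sum_congr rfl fun y _ => by rw [T.tracePreserving]; ring
        _ ≤ ∑ y, P y ^ α * Q y ^ (1 - α) * ∑ x, meanWeight α (D.u x) *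
              (ampliate (D.branch x) (T.toLin (W y))).trace.re :=
            Finset.sum_le_sum fun y _ => mul_le_mul_of_nonneg_left (h.ampliate (hTW y))
              (mul_nonneg (Real.rpow_nonneg (hP y) _) (Real.rpow_nonneg (hQ y) _))
        _ = _ := by
            rw [Fintype.sum_prod_type]
            refine Finset.sum_congr rfl fun y _ => ?_
            rw [Finset.mul_sum]
            refine Finset.sum_congr rfl fun x _ => ?_
            rw [Real.mul_rpow (hP y) (hu1 x), Real.mul_rpow (hQ y) (hu0 x), meanWeight]
            ring
    · rintro ⟨y, x⟩ h1 h2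
      have hP' : 0 < P y := (hP y).lt_of_ne fun h => by simp [← h] at h1
      have hQ' : 0 < Q y := (hQ y).lt_of_ne fun h => by simp [← h] at h2
      have h3 : 0 < 1 - D.u x := pos_of_mul_pos_right h1 hP'.le
      have h4 : 0 < D.u x := pos_of_mul_pos_right h2 hQ'.le
      have h5 : P y * (1 - D.u x) / (Q y * D.u x) = P y / Q y * ((1 - D.u x) / D.u x) := by
        rw [mul_div_mul_comm]
      simp only [h5]
      rw [Real.log_mul (div_pos hP' hQ').ne' (div_pos h3 h4).ne']
      refine (abs_add_le _ _).trans ?_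
      have := add_le_add (hlog y hP' hQ') (hK x h3 h4)
      push_cast; linarith

end

/-! ### Tensor powers and traces of positive matrices -/

section Tensor

variable {ι : Type*} {m : ℕ}

/-- The tensor product of a finite family of matrices. -/
def tensorFamily (X : Fin m → Matrix ι ι ℂ) : Matrix (Fin m → ι) (Fin m → ι) ℂ :=
  Matrix.of fun f g => ∏ i, X i (f i) (g i)

theorem tensorPow_sum_smul {Y : Type*} [Fintype Y] (c : Y → ℂ) (W : Y → Matrix ι ι ℂ) :
    tensorPow m (∑ y, c y • W y)
      = ∑ y : Fin m → Y, (∏ i, c (y i)) • tensorFamily fun i => W (y i) := by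
  ext f g
  simp only [tensorPow, tensorFamily, Matrix.of_apply, Matrix.sum_apply, Matrix.smul_apply,
    smul_eq_mul, ← Finset.prod_mul_distrib]
  exact (sum_prod_pi fun i y => c y * W y (f i) (g i)).symm

variable [Fintype ι]

theorem trace_tensorFamily (X : Fin m → Matrix ι ι ℂ) :
    (tensorFamily X).trace = ∏ i, (X i).trace := by
  simp only [Matrix.trace, tensorFamily, Matrix.diag_apply, Matrix.of_apply]
  exact sum_prod_pi fun i x => X i x x

open scoped MatrixOrder Matrix.Norms.L2Operator in
theorem exists_conjTranspose_mul_self [DecidableEq ι] {X : Matrix ι ι ℂ} (hX : X.PosSemidef) :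
    ∃ V : Matrix ι ι ℂ, X = V.conjTranspose * V :=
  CStarAlgebra.nonneg_iff_eq_star_mul_self.1 (Matrix.nonneg_iff_posSemidef.2 hX)

theorem tensorFamily_posSemidef [DecidableEq ι] {X : Fin m → Matrix ι ι ℂ}
    (hX : ∀ i, (X i).PosSemidef) : (tensorFamily X).PosSemidef := by
  choose V hV using fun i => exists_conjTranspose_mul_self (hX i)
  have : tensorFamily X = (tensorFamily V).conjTranspose * tensorFamily V := by
    ext f g
    simp only [tensorFamily, hV, Matrix.mul_apply, Matrix.of_apply, Matrix.conjTranspose_apply,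
      star_prod, ← Finset.prod_mul_distrib]
    exact (sum_prod_pi fun i x => star (V i x (f i)) * V i x (g i)).symm
  rw [this]
  exact Matrix.posSemidef_conjTranspose_mul_self _

theorem trace_mul_re_nonneg [DecidableEq ι] {X Z : Matrix ι ι ℂ} (hX : X.PosSemidef)
    (hZ : Z.PosSemidef) : 0 ≤ (X * Z).trace.re := by
  obtain ⟨V, rfl⟩ := exists_conjTranspose_mul_self hZ
  rw [← Matrix.mul_assoc, Matrix.trace_mul_comm, ← Matrix.mul_assoc]
  exact (Complex.le_def.1 (hX.mul_mul_conjTranspose_same V).trace_nonneg).1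

end Tensor

/-! ### Overlap of products of two weight functions -/

section Classical

variable {Y : Type*} [Fintype Y]

/-- Lower bound on the overlap of `m`-fold products of two weight functions with bounded
likelihood ratio on their common support. -/
theorem sum_prod_mul_min_ge' {P Q w : Y → ℝ} {K a G : ℝ} (hP : ∀ y, 0 ≤ P y) (hQ : ∀ y, 0 ≤ Q y)
    (hw : ∀ y, 0 ≤ w y) (hK0 : 0 ≤ K) (hK : ∀ y, 0 < P y → 0 < Q y → |Real.log (P y / Q y)| ≤ K)
    (hG : ∀ α ∈ Set.Ioo (0 : ℝ) 1,
      Real.exp (α * a + G) ≤ ∑ y, P y ^ α * Q y ^ (1 - α) * w y) (m : ℕ) :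
    Real.exp (m * (a + G) - (K + |a|) * √m)
      ≤ ∑ y : Fin m → Y, (∏ j, w (y j)) * min (∏ j, P (y j)) (Real.exp (m * a) * ∏ j, Q (y j)) := by
  classical
  -- Restriction to the common support loses nothing: elsewhere `P^α Q^(1-α)` vanishes for `α ∈ (0,
  -- 1)`. The shift by `a` moves the likelihood threshold to zero.
  let q : Y → ℝ := fun y => if 0 < P y ∧ 0 < Q y then Q y * w y else 0
  let l : Y → ℝ := fun y => if 0 < P y ∧ 0 < Q y then Real.log (P y / Q y) - a else 0
  have hq : ∀ y, 0 ≤ q y := fun y => by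
    simp only [q]; split_ifs
    · exact mul_nonneg (hQ y) (hw y)
    · exact le_rfl
  have hl : ∀ y, |l y| ≤ K + |a| := fun y => by
    simp only [l]; split_ifs with h
    · exact (abs_sub _ _).trans (add_le_add (hK y h.1 h.2) le_rfl)
    · rw [abs_zero]; positivity
  have hIoo : ∀ α ∈ Set.Ioo (0 : ℝ) 1, Real.exp G ≤ ∑ y, q y * Real.exp (α * l y) := by
    intro α hα
    have h1 : ∀ y, P y ^ α * Q y ^ (1 - α) * w y = Real.exp (α * a) * (q y * Real.exp (α * l y)) := by
      intro y
      by_cases h : 0 < P y ∧ 0 < Q y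
      · simp only [q, l, if_pos h]
        have h2 : Real.exp (α * (Real.log (P y / Q y) - a))
            = P y ^ α / Q y ^ α * (Real.exp (α * a))⁻¹ := by
          rw [mul_sub, Real.exp_sub, mul_comm α (Real.log _), ← Real.rpow_def_of_pos (div_pos h.1 h.2),
            Real.div_rpow h.1.le h.2.le]
          rfl
        have h3 : Q y ^ (1 - α) = Q y / Q y ^ α := by rw [Real.rpow_sub h.2, Real.rpow_one]
        have h4 := (Real.exp_pos (α * a)).ne'
        rw [h2, h3]
        field_simp
      · simp only [q, if_neg h, zero_mul, mul_zero]
        rw [not_and_or, not_lt, not_lt] at h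
        rcases h with h | h
        · rw [le_antisymm h (hP y), Real.zero_rpow hα.1.ne']; ring
        · rw [le_antisymm h (hQ y), Real.zero_rpow (by linarith [hα.2])]; ring
    have h2 := hG α hα
    simp only [h1] at h2
    rw [← Finset.mul_sum, Real.exp_add] at h2
    exact le_of_mul_le_mul_left h2 (Real.exp_pos _)
  -- The finite sum of exponentials is continuous in `α`, so the bound reaches the endpoints, where
  -- the powers of `P` and `Q` could ignore the support.
  have hIcc : ∀ α ∈ Set.Icc (0 : ℝ) 1, Real.exp G ≤ ∑ y, q y * Real.exp (α * l y) := by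
    intro α hα
    have hc : IsClosed {α : ℝ | Real.exp G ≤ ∑ y, q y * Real.exp (α * l y)} :=
      isClosed_le continuous_const (by fun_prop)
    have := closure_minimal (s := Set.Ioo (0 : ℝ) 1) hIoo hc
    rw [closure_Ioo zero_ne_one] at this
    exact this hα
  have key := sum_prod_mul_min_ge hq hl hIcc m
  calc Real.exp (m * (a + G) - (K + |a|) * √m)
      = Real.exp (m * a) * Real.exp (m * G - (K + |a|) * √m) := by rw [← Real.exp_add]; congr 1; ring
    _ ≤ Real.exp (m * a) *
        ∑ y : Fin m → Y, (∏ j, q (y j)) * min (Real.exp (∑ j, l (y j))) 1 := by gcongr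
    _ ≤ _ := by
      rw [Finset.mul_sum]
      refine Finset.sum_le_sum fun y _ => ?_
      by_cases h : ∀ j, 0 < P (y j) ∧ 0 < Q (y j)
      · have h1 : ∏ j, q (y j) = (∏ j, Q (y j)) * ∏ j, w (y j) := by
          rw [← Finset.prod_mul_distrib]
          exact Finset.prod_congr rfl fun j _ => by simp only [q, if_pos (h j)]
        have h2 : Real.exp (m * a) * ((∏ j, Q (y j)) * Real.exp (∑ j, l (y j))) = ∏ j, P (y j) := by
          have : (m : ℝ) * a = ∑ _j : Fin m, a := by simp
          rw [this, Real.exp_sum, Real.exp_sum, ← Finset.prod_mul_distrib,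
            ← Finset.prod_mul_distrib]
          refine Finset.prod_congr rfl fun j _ => ?_
          simp only [l, if_pos (h j)]
          rw [Real.exp_sub, Real.exp_log (div_pos (h j).1 (h j).2)]
          have := (h j).2.ne'
          have := (Real.exp_pos a).ne'
          field_simp
        rw [h1, ← h2]
        have h3 : 0 ≤ ∏ j, Q (y j) := Finset.prod_nonneg fun j _ => hQ _
        have h4 := (Real.exp_pos (m * a)).le
        rw [← mul_min_of_nonneg _ _ h4]
        have h5 : min ((∏ j, Q (y j)) * Real.exp (∑ j, l (y j))) (∏ j, Q (y j))
            = (∏ j, Q (y j)) * min (Real.exp (∑ j, l (y j))) 1 := by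
          rw [mul_min_of_nonneg _ _ h3, mul_one]
        rw [h5]
        exact le_of_eq (by ring)
      · push Not at h
        obtain ⟨j, hj⟩ := h
        have : ∏ j, q (y j) = 0 := Finset.prod_eq_zero (Finset.mem_univ j) (by
          simp only [q]; exact if_neg fun h => (hj h.1).not_gt h.2)
        rw [this, zero_mul, mul_zero]
        exact mul_nonneg (Finset.prod_nonneg fun j _ => hw _)
          (le_min (Finset.prod_nonneg fun j _ => hP _)
            (mul_nonneg (Real.exp_pos _).le (Finset.prod_nonneg fun j _ => hQ _)))

end Classical

/-! ### Trade-off between the two error probabilities -/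

section

variable {A : Type u} {B : Type v} [Fintype A] [Fintype B] [DecidableEq B]

omit [DecidableEq B] in
theorem SeqStrategy.finalState_posSemidef (N : QChannel A B) {n k : ℕ} (S : SeqStrategy A B n k) :
    (S.finalState N).PosSemidef := by
  induction S with
  | start ρ => exact N.completelyPositive _ _ ρ.posSemidef
  | step S T ih => exact N.completelyPositive _ _ (T.map_posSemidef ih)

theorem RepProtocol.typeII_nonneg {n m : ℕ} (P : RepProtocol A B n m) (M : QChannel A B) :
    0 ≤ P.typeII M :=
  trace_mul_re_nonneg P.test.posSemidef
    (tensorFamily_posSemidef fun _ => P.strategy.finalState_posSemidef M)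

theorem RepProtocol.typeI_nonneg {n m : ℕ} (P : RepProtocol A B n m) (N : QChannel A B) :
    0 ≤ P.typeI N :=
  trace_mul_re_nonneg P.test.compl_posSemidef
    (tensorFamily_posSemidef fun _ => P.strategy.finalState_posSemidef N)

/-- The trade-off between the two error probabilities of a protocol, with constants that depend
only on the two channels and the number of calls. -/
theorem RepProtocol.exp_le_typeI_add {N M : QChannel A B} (D : ChannelDecomposition N M) {K : ℝ}
    (hK0 : 0 ≤ K)
    (hK : ∀ x, 0 < 1 - D.u x → 0 < D.u x → |Real.log ((1 - D.u x) / D.u x)| ≤ K) {a G : ℝ}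
    (hG : ∀ α ∈ Set.Ioo (0 : ℝ) 1, D.QuasiBound α (Real.exp (α * a + G))) {n m : ℕ}
    (P : RepProtocol A B n m) :
    Real.exp (m * (n * (a + G)) - n * (K + |a|) * √m)
      ≤ P.typeI N + Real.exp (m * (n * a)) * P.typeII M := by
  obtain ⟨Y, _, p, q, W, hp, hq, hW, hpW, hqW, hc, hlog⟩ :=
    exists_strategy_decomposition D hK P.strategy
  have hw : ∀ y, 0 ≤ (W y).trace.re := fun y => (Complex.le_def.1 (hW y).trace_nonneg).1
  have key := sum_prod_mul_min_ge' (w := fun y => (W y).trace.re) (a := n * a) (G := n * G) hp hq hw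
    (by positivity : (0 : ℝ) ≤ n * K) hlog (fun α hα => by
      have := hc α _ (Real.exp_pos _).le (hG α hα)
      rw [← Real.exp_nat_mul] at this
      convert this using 2
      ring) m
  have h1 : (m : ℝ) * (n * (a + G)) - n * (K + |a|) * √m
      = m * (n * a + n * G) - (n * K + |n * a|) * √m := by
    rw [abs_mul, Nat.abs_cast]; ring
  rw [h1]
  refine key.trans ?_
  let X : (Fin m → Y) → Matrix _ _ ℂ := fun y => tensorFamily fun i => W (y i)
  have hX : ∀ y, (X y).PosSemidef := fun y => tensorFamily_posSemidef fun i => hW _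
  have hexp : ∀ (Z : Matrix (Fin m → Fin P.refDim × B) (Fin m → Fin P.refDim × B) ℂ) (c : Y → ℝ)
      (ω : Matrix (Fin P.refDim × B) (Fin P.refDim × B) ℂ), ω = ∑ y, (c y : ℂ) • W y →
      (Z * tensorPow m ω).trace.re = ∑ y : Fin m → Y, (∏ i, c (y i)) * (Z * X y).trace.re := by
    intro Z c ω hω
    rw [hω, tensorPow_sum_smul, Matrix.mul_sum, Matrix.trace_sum, Complex.re_sum]
    refine Finset.sum_congr rfl fun y _ => ?_
    rw [Matrix.mul_smul, Matrix.trace_smul, smul_eq_mul, ← Complex.ofReal_prod,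
      Complex.re_ofReal_mul]
  rw [RepProtocol.typeI, RepProtocol.typeII, hexp _ p _ hpW, hexp _ q _ hqW, Finset.mul_sum,
    ← Finset.sum_add_distrib]
  refine Finset.sum_le_sum fun y _ => ?_
  -- The test splits the trace of each branch into a rejected and an accepted part, weighted by `∏
  -- p` and `e^{mna} ∏ q`; replacing both by their minimum leaves the classical overlap.
  have h2 : ∏ j, (W (y j)).trace.re
      = ((1 - P.test.op) * X y).trace.re + (P.test.op * X y).trace.re := by
    rw [← Complex.add_re, ← Matrix.trace_add, ← Matrix.add_mul, sub_add_cancel, Matrix.one_mul,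
      trace_tensorFamily]
    have : ∀ j, (W (y j)).trace = ((W (y j)).trace.re : ℂ) := fun j =>
      Complex.ext rfl (Complex.le_def.1 (hW (y j)).trace_nonneg).2.symm
    conv_rhs => rw [Finset.prod_congr rfl fun j _ => this j]
    rw [← Complex.ofReal_prod, Complex.ofReal_re]
  have h3 := trace_mul_re_nonneg P.test.compl_posSemidef (hX y)
  have h4 := trace_mul_re_nonneg P.test.posSemidef (hX y)
  rw [h2, add_mul]
  have h5 := mul_le_mul_of_nonneg_right (min_le_left (∏ j, p (y j))
    (Real.exp (m * (n * a)) * ∏ j, q (y j))) h3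
  have h6 := mul_le_mul_of_nonneg_right (min_le_right (∏ j, p (y j))
    (Real.exp (m * (n * a)) * ∏ j, q (y j))) h4
  linarith

end

/-! ### Nonnegativity and monotonicity in the order -/

section

variable {A : Type u} {B : Type v} [Fintype A] [Fintype B] [DecidableEq B] {N M : QChannel A B}

theorem ChannelDecomposition.branch_trace_nonneg (D : ChannelDecomposition N M) (x : A × B)
    {ψ : Matrix A A ℂ} (hψ : ψ.PosSemidef) : 0 ≤ (D.branch x ψ).trace.re := by
  have h := ampliate_ofChoi_posSemidef (R := Unit) (D.t x) (hψ.submatrix Prod.snd)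
  have := (Complex.le_def.1 h.trace_nonneg).1
  rw [trace_ampliate] at this
  have hm : marginal (ψ.submatrix (Prod.snd : Unit × A → A) Prod.snd) = ψ := by
    ext a b; simp [marginal]
  rwa [hm] at this

theorem ChannelDecomposition.sum_left (D : ChannelDecomposition N M) (ψ : Matrix A A ℂ) :
    ∑ x, (1 - D.u x) * (D.branch x ψ).trace.re = ψ.trace.re := by
  rw [← N.tracePreserving, D.left]
  simp only [LinearMap.sum_apply, LinearMap.smul_apply, Matrix.trace_sum, Matrix.trace_smul,
    smul_eq_mul, Complex.re_sum, Complex.re_ofReal_mul]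
  rfl

theorem ChannelDecomposition.sum_right (D : ChannelDecomposition N M) (ψ : Matrix A A ℂ) :
    ∑ x, D.u x * (D.branch x ψ).trace.re = ψ.trace.re := by
  rw [← M.tracePreserving, D.right]
  simp only [LinearMap.sum_apply, LinearMap.smul_apply, Matrix.trace_sum, Matrix.trace_smul,
    smul_eq_mul, Complex.re_sum, Complex.re_ofReal_mul]
  rfl

theorem ChannelDecomposition.QuasiBound.mono {D : ChannelDecomposition N M} {α c c' : ℝ}
    (h : D.QuasiBound α c') (hc : c ≤ c') : D.QuasiBound α c := fun ψ hψ =>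
  (mul_le_mul_of_nonneg_right hc (Complex.le_def.1 hψ.trace_nonneg).1).trans (h ψ hψ)

theorem ChannelDecomposition.quasiBound (D : ChannelDecomposition N M) {α d : ℝ}
    (hα : α ∈ Set.Ioo (0 : ℝ) 1) (hd : geomRenyiChannel α N M ≤ d) :
    D.QuasiBound α (Real.exp ((α - 1) * d)) := D.bound α hα d hd

/-- Weighted AM-GM gives `meanWeight α u ≤ α (1 - u) + (1 - α) u`. Summed at the input `ψ = 1`,
whose trace is positive, this forces `e^{(α-1)d} ≤ 1`. -/
theorem nonneg_of_geomRenyiChannel_le [Nonempty A] (D : ChannelDecomposition N M) {α d : ℝ}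
    (hα : α ∈ Set.Ioo (0 : ℝ) 1) (hd : geomRenyiChannel α N M ≤ d) : 0 ≤ d := by
  classical
  have h1 : (1 : Matrix A A ℂ).PosSemidef := Matrix.PosSemidef.one
  have h := D.quasiBound hα hd 1 h1
  have htr : 0 < (1 : Matrix A A ℂ).trace.re := by simp [Matrix.trace_one, Fintype.card_pos]
  have h2 : ∑ x, meanWeight α (D.u x) * (D.branch x 1).trace.re ≤ (1 : Matrix A A ℂ).trace.re := by
    calc _ ≤ ∑ x, (α * ((1 - D.u x) * (D.branch x 1).trace.re)
          + (1 - α) * (D.u x * (D.branch x 1).trace.re)) := by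
          refine Finset.sum_le_sum fun x _ => ?_
          have h3 := Real.geom_mean_le_arith_mean2_weighted hα.1.le (sub_nonneg.2 hα.2.le)
            (sub_nonneg.2 (D.mem_Icc x).2) (D.mem_Icc x).1 (by ring)
          have := mul_le_mul_of_nonneg_right h3 (D.branch_trace_nonneg x h1)
          rw [meanWeight]
          linarith
      _ = _ := by
          rw [Finset.sum_add_distrib, ← Finset.mul_sum, ← Finset.mul_sum, D.sum_left, D.sum_right]
          ring
  have h3 : Real.exp ((α - 1) * d) ≤ 1 := by
    by_contra hlt
    rw [not_le] at hlt
    nlinarith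
  rw [Real.exp_le_one_iff] at h3
  nlinarith [hα.2]

/-- Monotonicity in `α` of the Rényi entropy, on the level of a decomposition. -/
theorem ChannelDecomposition.QuasiBound.of_le {D : ChannelDecomposition N M} {α β s : ℝ}
    (hα : 0 < α) (hαβ : α ≤ β) (hβ : β < 1) (h : D.QuasiBound β (Real.exp ((β - 1) * s))) :
    D.QuasiBound α (Real.exp ((α - 1) * s)) := by
  intro ψ hψ
  have hb := h ψ hψ
  set z := Real.exp ((α - 1) * s)
  have hz : 0 < z := Real.exp_pos _
  have hα1 : 0 < 1 - α := by linarith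
  -- The exponent with `meanWeight β u = (meanWeight α u)^θ (1 - u)^(1-θ)`.
  set θ := (1 - β) / (1 - α) with hθ
  have hθ0 : 0 < θ := div_pos (by linarith) hα1
  have hθ1 : θ ≤ 1 := (div_le_one hα1).2 (by linarith)
  have hθα : (1 - α) * θ = 1 - β := by rw [hθ]; field_simp
  have hzθ : z ^ θ = Real.exp ((β - 1) * s) := by
    rw [← Real.exp_mul]; congr 1; linear_combination -s * hθα
  have hzθ0 : 0 < z ^ θ := Real.rpow_pos_of_pos hz _
  -- Hölder's inequality in linearised form: AM-GM with the first factor normalised by the target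
  -- value `z`.
  have hterm : ∀ x, meanWeight β (D.u x) * (D.branch x ψ).trace.re
      ≤ z ^ θ * (θ / z * (meanWeight α (D.u x) * (D.branch x ψ).trace.re)
        + (1 - θ) * ((1 - D.u x) * (D.branch x ψ).trace.re)) := by
    intro x
    have hu0 := (D.mem_Icc x).1
    have hu1 : 0 ≤ 1 - D.u x := sub_nonneg.2 (D.mem_Icc x).2
    have h1 := Real.geom_mean_le_arith_mean2_weighted hθ0.le (sub_nonneg.2 hθ1)
      (div_nonneg (meanWeight_nonneg α (D.mem_Icc x)) hz.le) hu1 (by ring)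
    have h2 : (meanWeight α (D.u x) / z) ^ θ * (1 - D.u x) ^ (1 - θ)
        = meanWeight β (D.u x) / z ^ θ := by
      rw [Real.div_rpow (meanWeight_nonneg α (D.mem_Icc x)) hz.le, meanWeight, meanWeight,
        Real.mul_rpow (Real.rpow_nonneg hu1 _) (Real.rpow_nonneg hu0 _), ← Real.rpow_mul hu1,
        ← Real.rpow_mul hu0, hθα]
      have h3 : (1 - D.u x) ^ (α * θ) * (1 - D.u x) ^ (1 - θ) = (1 - D.u x) ^ β := by
        rw [← Real.rpow_add_of_nonneg hu1 (by positivity) (by linarith)]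
        congr 1; linear_combination -hθα
      rw [← h3]; ring
    rw [h2, div_le_iff₀ hzθ0] at h1
    have := mul_le_mul_of_nonneg_right h1 (D.branch_trace_nonneg x hψ)
    refine this.trans (le_of_eq ?_)
    ring
  have hsum := hb.trans (Finset.sum_le_sum fun x _ => hterm x)
  rw [← Finset.mul_sum, Finset.sum_add_distrib, ← Finset.mul_sum, ← Finset.mul_sum, D.sum_left,
    ← hzθ] at hsum
  have h1 := le_of_mul_le_mul_left hsum hzθ0
  have h2 : θ * ψ.trace.re
      ≤ θ * (1 / z * ∑ x, meanWeight α (D.u x) * (D.branch x ψ).trace.re) := by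
    have : θ / z = θ * (1 / z) := by ring
    rw [this] at h1
    linarith
  have h3 := le_of_mul_le_mul_left h2 hθ0
  rw [one_div_mul_eq_div, le_div_iff₀ hz] at h3
  linarith

end

/-! ### Asymptotic exponents -/

section Exponents

theorem errExponent_le {n m : ℕ} (hn : 0 < n) (hm : 0 < m) {t : ℝ} {x : ℝ≥0∞}
    (h : ENNReal.ofReal (Real.exp (-(n * m * t))) ≤ x) : errExponent n m x ≤ t := by
  have h1 := ENNReal.log_monotone h
  rw [log_ofReal_exp] at h1
  have hnm : (0 : ℝ) < (n : ℝ) * m := mul_pos (Nat.cast_pos.2 hn) (Nat.cast_pos.2 hm)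
  rw [errExponent]
  generalize (n : ℝ) * m = c at h1 hnm ⊢
  have hc := one_div_pos.2 hnm
  induction hx : ENNReal.log x with
  | bot => rw [hx] at h1; exact absurd h1 (EReal.bot_lt_coe _).not_ge
  | top => rw [EReal.coe_mul_top_of_pos hc]; simp
  | coe y =>
    rw [hx, EReal.coe_le_coe_iff] at h1
    rw [← EReal.coe_mul, ← EReal.coe_neg, EReal.coe_le_coe_iff, neg_le, one_div_mul_eq_div,
      le_div_iff₀ hnm]
    linarith

theorem le_exp_of_le_errExponent {n m : ℕ} (hn : 0 < n) (hm : 0 < m) {r x : ℝ}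
    (h : (r : EReal) ≤ errExponent n m (ENNReal.ofReal x)) : x ≤ Real.exp (-(n * m * r)) := by
  have hnm : (0 : ℝ) < (n : ℝ) * m := mul_pos (Nat.cast_pos.2 hn) (Nat.cast_pos.2 hm)
  rw [errExponent] at h
  generalize (n : ℝ) * m = c at h hnm ⊢
  have hc := one_div_pos.2 hnm
  by_contra hlt
  rw [not_le] at hlt
  have h1 := ENNReal.log_strictMono
    ((ENNReal.ofReal_lt_ofReal_iff ((Real.exp_pos _).trans hlt)).2 hlt)
  rw [log_ofReal_exp] at h1
  induction hx : ENNReal.log (ENNReal.ofReal x) with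
  | bot => rw [hx] at h1; exact absurd h1 (by simp)
  | top => rw [hx, EReal.coe_mul_top_of_pos hc] at h; exact absurd h (by simp)
  | coe y =>
    rw [hx, EReal.coe_lt_coe_iff] at h1
    rw [hx, ← EReal.coe_mul, ← EReal.coe_neg, EReal.coe_le_coe_iff, le_neg, one_div_mul_eq_div,
      div_le_iff₀ hnm] at h
    linarith

theorem eventually_le_mul_sub_mul_sqrt {s : ℝ} (hs : 0 < s) (c L : ℝ) :
    ∀ᶠ m : ℕ in atTop, L ≤ m * s - c * √m := by
  have h : Tendsto (fun m : ℕ => √(m : ℝ)) atTop atTop :=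
    Real.tendsto_sqrt_atTop.comp tendsto_natCast_atTop_atTop
  filter_upwards [h.eventually_ge_atTop ((c + 1) / s), h.eventually_ge_atTop L] with m h1 h2
  rw [div_le_iff₀ hs] at h1
  have h3 : √(m : ℝ) * √m = m := Real.mul_self_sqrt (Nat.cast_nonneg m)
  have h4 := Real.sqrt_nonneg (m : ℝ)
  nlinarith

theorem limsup_limsup_le {f : ℕ → ℕ → EReal} {b : EReal}
    (h : ∀ n, 0 < n → ∀ᶠ m in atTop, f n m ≤ b) :
    limsup (fun n => limsup (fun m => f n m) atTop) atTop ≤ b := by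
  refine limsup_le_of_le (by isBoundedDefault) ?_
  filter_upwards [eventually_gt_atTop 0] with n hn
  exact limsup_le_of_le (by isBoundedDefault) (h n hn)

variable {A : Type u} {B : Type v} [Fintype A] [Fintype B]

theorem isEmpty_seqStrategy [IsEmpty A] {n k : ℕ} : IsEmpty (SeqStrategy A B n k) := by
  refine ⟨fun S => ?_⟩
  induction S with
  | start ρ => simpa [Matrix.trace] using ρ.trace_eq_one
  | step S T ih => exact ih

variable [DecidableEq B]

theorem ChannelDecomposition.exists_log_bound {N M : QChannel A B}
    (D : ChannelDecomposition N M) :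
    ∃ K : ℝ, 0 ≤ K ∧
      ∀ x, 0 < 1 - D.u x → 0 < D.u x → |Real.log ((1 - D.u x) / D.u x)| ≤ K := by
  refine ⟨∑ x, |Real.log ((1 - D.u x) / D.u x)|, Finset.sum_nonneg fun x _ => abs_nonneg _,
    fun x _ _ => ?_⟩
  exact Finset.single_le_sum (f := fun x => |Real.log ((1 - D.u x) / D.u x)|)
    (fun x _ => abs_nonneg _) (Finset.mem_univ x)

theorem chernoffExp_limsup_le (N M : QChannel A B) {p : ℝ} (hp : p ∈ Set.Ioo (0 : ℝ) 1) :
    limsup (fun n : ℕ => limsup (fun m : ℕ => chernoffExp p N M n m) atTop) atTop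
      ≤ geomChernoff N M := by
  classical
  obtain ⟨D⟩ := exists_channelDecomposition N M
  obtain ⟨K, hK0, hK⟩ := D.exists_log_bound
  refine EReal.le_of_forall_lt_iff_le.1 fun z hz => ?_
  obtain ⟨c, hc, hcz⟩ := EReal.lt_iff_exists_real_btwn.1 hz
  have hcz : c < z := by exact_mod_cast hcz
  -- The Chernoff case weights both errors equally, so `a = 0`. The gap `z - c` later absorbs the
  -- prior and the `√m` term.
  have hD : ∀ α ∈ Set.Ioo (0 : ℝ) 1, D.QuasiBound α (Real.exp (α * 0 + -c)) := by
    intro α hα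
    have h1 : ((1 - α : ℝ) : EReal) * geomRenyiChannel α N M ≤ c :=
      (le_iSup₂ (f := fun α (_ : α ∈ Set.Ioo (0 : ℝ) 1) =>
        ((1 - α : ℝ) : EReal) * geomRenyiChannel α N M) α hα).trans hc.le
    have hα1 : 0 < 1 - α := by linarith [hα.2]
    have h2 : geomRenyiChannel α N M ≤ ((c / (1 - α) : ℝ) : EReal) := by
      induction hx : geomRenyiChannel α N M with
      | bot => exact bot_le
      | top => rw [hx, EReal.coe_mul_top_of_pos hα1] at h1; exact absurd h1 (by simp)
      | coe y =>
        rw [hx] at h1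
        norm_cast at h1 ⊢
        rw [le_div_iff₀ hα1]; linarith
    refine (D.quasiBound hα h2).mono (le_of_eq ?_)
    congr 1
    field_simp; ring
  refine limsup_limsup_le fun n hn => ?_
  have hn' : (0 : ℝ) < n := Nat.cast_pos.2 hn
  have hp0 : 0 < min p (1 - p) := lt_min hp.1 (sub_pos.2 hp.2)
  filter_upwards [eventually_le_mul_sub_mul_sqrt (mul_pos hn' (sub_pos.2 hcz)) (n * (K + |0|))
    (-Real.log (min p (1 - p))), eventually_gt_atTop 0] with m hm hm0
  refine errExponent_le hn hm0 (le_iInf fun P => ENNReal.ofReal_le_ofReal ?_)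
  have key := P.exp_le_typeI_add D hK0 hK hD
  rw [mul_zero, mul_zero, Real.exp_zero, one_mul] at key
  have h1 := mul_le_mul_of_nonneg_left key hp0.le
  have h2 := mul_le_mul_of_nonneg_right (min_le_left p (1 - p)) (P.typeI_nonneg N)
  have h3 := mul_le_mul_of_nonneg_right (min_le_right p (1 - p)) (P.typeII_nonneg M)
  have h4 : Real.exp (-(n * m * z))
      ≤ min p (1 - p) * Real.exp (m * (n * (0 + -c)) - n * (K + |0|) * √m) := by
    nth_rewrite 1 [← Real.exp_log hp0]
    rw [← Real.exp_add, Real.exp_le_exp]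
    linarith
  linarith

theorem hoeffdingExp_limsup_le (N M : QChannel A B) {r : ℝ} (hr : 0 < r)
    (hne : (r : EReal) ≠ ⨅ α ∈ Set.Ioo (0 : ℝ) 1, geomRenyiChannel α N M) :
    limsup (fun n : ℕ => limsup (fun m : ℕ => hoeffdingExp r N M n m) atTop) atTop
      ≤ ⨆ α ∈ Set.Ioo (0 : ℝ) 1, (((α - 1) / α : ℝ) : EReal) *
          ((r : EReal) - geomRenyiChannel α N M) := by
  classical
  obtain ⟨D⟩ := exists_channelDecomposition N M
  obtain ⟨K, hK0, hK⟩ := D.exists_log_bound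
  refine EReal.le_of_forall_lt_iff_le.1 fun z hz => ?_
  -- If `A` is empty there are no protocols and the supremum is `-∞`; nonnegativity of the
  -- divergence, used below, needs `A` nonempty.
  rcases isEmpty_or_nonempty A with hA | hA
  · refine limsup_limsup_le fun n hn => Eventually.of_forall fun m => ?_
    exact iSup_le fun P => (isEmpty_seqStrategy.false P.strategy).elim
  obtain ⟨R, hR, hRz⟩ := EReal.lt_iff_exists_real_btwn.1 hz
  have hRz : R < z := by exact_mod_cast hRz
  have hD : ∀ α ∈ Set.Ioo (0 : ℝ) 1,
      geomRenyiChannel α N M ≤ ((r + α * R / (1 - α) : ℝ) : EReal) := by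
    intro α hα
    have h1 : (((α - 1) / α : ℝ) : EReal) * ((r : EReal) - geomRenyiChannel α N M) ≤ R :=
      (le_iSup₂ (f := fun α (_ : α ∈ Set.Ioo (0 : ℝ) 1) => (((α - 1) / α : ℝ) : EReal) *
          ((r : EReal) - geomRenyiChannel α N M)) α hα).trans hR.le
    have hα1 : 0 < 1 - α := by linarith [hα.2]
    have hneg : (α - 1) / α < 0 := div_neg_of_neg_of_pos (by linarith) hα.1
    induction hx : geomRenyiChannel α N M with
    | bot => exact bot_le
    | top =>
      rw [hx, EReal.sub_top, EReal.coe_mul_bot_of_neg hneg] at h1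
      exact absurd h1 (by simp)
    | coe y =>
      rw [hx] at h1
      norm_cast at h1 ⊢
      rw [div_mul_eq_mul_div, div_le_iff₀ hα.1] at h1
      rw [← sub_le_iff_le_add', le_div_iff₀ hα1]
      linarith
  have hR0 : 0 ≤ R := by
    by_contra hneg
    rw [not_le] at hneg
    have hrR : 0 < r - R := by linarith
    -- If `R < 0`, the bound `r + αR/(1 - α)` is negative once `α > r / (r - R)`, contradicting
    -- nonnegativity of the divergence.
    let α := (1 + r / (r - R)) / 2
    have h1 : r / (r - R) < 1 := (div_lt_one hrR).2 (by linarith)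
    have h2 : 0 < r / (r - R) := div_pos hr hrR
    have hα : α ∈ Set.Ioo (0 : ℝ) 1 := ⟨by simp only [α]; linarith, by simp only [α]; linarith⟩
    have h3 := nonneg_of_geomRenyiChannel_le D hα (hD α hα)
    have hα1 : 0 < 1 - α := by linarith [hα.2]
    have h4 : 0 ≤ (r + α * R / (1 - α)) * (1 - α) := mul_nonneg h3 hα1.le
    have h5 : (r + α * R / (1 - α)) * (1 - α) = r - α * (r - R) := by field_simp; ring
    have h6 : r / (r - R) < α := by simp only [α]; linarith
    rw [div_lt_iff₀ hrR] at h6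
    linarith
  -- Small `α` in the bound `r + αR/(1 - α)` gives only `≤ r`; strictness is where `r ≠ inf` enters.
  have hinf : (⨅ α ∈ Set.Ioo (0 : ℝ) 1, geomRenyiChannel α N M) < r := by
    refine lt_of_le_of_ne (EReal.le_of_forall_lt_iff_le.1 fun y hy => ?_) hne.symm
    have hy : r < y := by exact_mod_cast hy
    have hs : 0 < y - r := sub_pos.2 hy
    have hsR : 0 < y - r + R + 1 := by linarith
    have hα : (y - r) / (y - r + R + 1) ∈ Set.Ioo (0 : ℝ) 1 :=
      ⟨by positivity, (div_lt_one hsR).2 (by linarith)⟩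
    refine (iInf₂_le _ hα).trans ((hD _ hα).trans ?_)
    have h1 : (y - r) / (y - r + R + 1) * R / (1 - (y - r) / (y - r + R + 1))
        = (y - r) * R / (R + 1) := by
      have h2 : 1 - (y - r) / (y - r + R + 1) = (R + 1) / (y - r + R + 1) := by
        field_simp; ring
      rw [h2]; field_simp
    rw [h1]
    norm_cast
    have h3 : (y - r) * R / (R + 1) ≤ y - r := by
      rw [div_le_iff₀ (by linarith)]; nlinarith
    linarith
  obtain ⟨β, hβ⟩ := iInf_lt_iff.1 hinf
  obtain ⟨hβ1, hβr⟩ := iInf_lt_iff.1 hβ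
  obtain ⟨s, hs, hsr⟩ := EReal.lt_iff_exists_real_btwn.1 hβr
  have hsr : s < r := by exact_mod_cast hsr
  set η := z - R with hη
  have hη0 : 0 < η := sub_pos.2 hRz
  -- A gain uniform in `α`. For `α ≥ β` the slack `η` contributes `α η ≥ β η`; near `α = 0` this
  -- fails, and monotonicity with `D̂_β ≤ s < r` contributes at least `(1 - β)(r - s)`.
  set δ := min (β * η) ((1 - β) * (r - s)) with hδ
  have hδ0 : 0 < δ := lt_min (mul_pos hβ1.1 hη0) (mul_pos (by linarith [hβ1.2]) (by linarith))
  -- This is `r - z`, so that a type II error of at most `e^{-nmr}` carries weight at most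
  -- `e^{-nmz}`.
  set a := r - R - η with ha
  have hG : ∀ α ∈ Set.Ioo (0 : ℝ) 1, D.QuasiBound α (Real.exp (α * a + -(r - δ))) := by
    intro α hα
    rcases le_total α β with hle | hle
    · refine ((D.quasiBound hβ1 hs.le).of_le hα.1 hle hβ1.2).mono (Real.exp_le_exp.2 ?_)
      have h1 : δ ≤ (1 - β) * (r - s) := min_le_right _ _
      have h2 : α * (R + η) ≥ 0 := mul_nonneg hα.1.le (by linarith)
      have h3 : α * (r - s) ≤ β * (r - s) := mul_le_mul_of_nonneg_right hle (by linarith)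
      rw [ha]
      linarith
    · refine (D.quasiBound hα (hD α hα)).mono (Real.exp_le_exp.2 ?_)
      have hα1 : 0 < 1 - α := by linarith [hα.2]
      have h1 : (α - 1) * (r + α * R / (1 - α)) = -(1 - α) * r - α * R := by field_simp; ring
      have h2 : δ ≤ β * η := min_le_left _ _
      have h3 : β * η ≤ α * η := mul_le_mul_of_nonneg_right hle hη0.le
      rw [h1, ha]
      linarith
  refine limsup_limsup_le fun n hn => ?_
  have hn' : (0 : ℝ) < n := Nat.cast_pos.2 hn
  filter_upwards [eventually_le_mul_sub_mul_sqrt (mul_pos hn' hδ0) (n * (K + |a|)) 1,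
    eventually_gt_atTop 0] with m hm hm0
  refine iSup₂_le fun P hP => errExponent_le hn hm0 (ENNReal.ofReal_le_ofReal ?_)
  have hII := le_exp_of_le_errExponent hn hm0 hP
  have key := P.exp_le_typeI_add D hK0 hK hG
  have h1 : Real.exp (m * (n * a)) * P.typeII M ≤ Real.exp (-(n * m * z)) := by
    calc _ ≤ Real.exp (m * (n * a)) * Real.exp (-(n * m * r)) := by gcongr
      _ = _ := by rw [← Real.exp_add, ha, hη]; congr 1; ring
  -- The gain `mnδ` outgrows the `√m` loss by at least `1`, and `e ≥ 2`; one copy of `e^{-nmz}` pays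
  -- for the type II term and the other bounds type I.
  have h2 : 2 * Real.exp (-(n * m * z))
      ≤ Real.exp (m * (n * (a + -(r - δ))) - n * (K + |a|) * √m) := by
    have h3 : (m : ℝ) * (n * (a + -(r - δ))) - n * (K + |a|) * √m
        = (m * (n * δ) - n * (K + |a|) * √m) + -(n * m * z) := by
      have : a = r - z := by rw [ha, hη]; ring
      have h4 : a + -(r - δ) = δ - z := by rw [this]; ring
      rw [h4]; ring
    rw [h3, Real.exp_add]
    refine mul_le_mul_of_nonneg_right ?_ (Real.exp_pos _).le
    have := Real.add_one_le_exp ((m : ℝ) * (n * δ) - n * (K + |a|) * √m)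
    linarith
  linarith

end Exponents

end ChannelDiscrimination

theorem mainTheorem10 {A : Type*} {B : Type*} [Fintype A] [Fintype B] [DecidableEq B]
    (N M : ChannelDiscrimination.QChannel A B) :
    (∀ p ∈ Set.Ioo (0 : ℝ) 1,
      limsup (fun n : ℕ =>
          limsup (fun m : ℕ => ChannelDiscrimination.chernoffExp p N M n m) atTop) atTop
        ≤ ChannelDiscrimination.geomChernoff N M) ∧
    (∀ r : ℝ, 0 < r →
      (r : EReal) ≠ ⨅ α ∈ Set.Ioo (0 : ℝ) 1, ChannelDiscrimination.geomRenyiChannel α N M →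
      limsup (fun n : ℕ =>
          limsup (fun m : ℕ => ChannelDiscrimination.hoeffdingExp r N M n m) atTop) atTop
        ≤ ⨆ α ∈ Set.Ioo (0 : ℝ) 1, (((α - 1) / α : ℝ) : EReal) *
            ((r : EReal) - ChannelDiscrimination.geomRenyiChannel α N M)) :=
  ⟨fun _ hp => ChannelDiscrimination.chernoffExp_limsup_le N M hp,
    fun _ hr hne => ChannelDiscrimination.hoeffdingExp_limsup_le N M hr hne⟩
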